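/- Let $\mathcal S\subset\mathbb R^{n+1}$ be a smooth embedded hypersurface, let $p\in\mathcal S$, and let $\boldsymbol N$ be a smooth unit normal vector field of $\mathcal S$ around $p$. Let $\kappa_1,\dots,\kappa_n$ be the principal curvatures of $\mathcal S$ at $p$, i.e. the eigenvalues, listed with multiplicity, of the shape operator $\boldsymbol x\mapsto-\overline\nabla_{\boldsymbol x}\boldsymbol N$ on $T_p\mathcal S$, where $\overline\nabla$ is the directional derivative in $\mathbb R^{n+1}$. For small $\varepsilon>0$ the hypersurface separates the closed ball of radius $\varepsilon$ centered at $p$ into two connected components; let $V_p^+(\varepsilon)$ be the one into which $\boldsymbol N(p)$ points. For a measurable bounded set $D\subset\mathbb R^{n+1}$ of positive volume $V(D)$, with barycenter $\boldsymbol s(D)=\frac1{V(D)}\int_D\boldsymbol X\,\mathrm{dVol}$, the covariance matrix is $$C(D)=\int_D(\boldsymbol X-\boldsymbol s(D))\otimes(\boldsymbol X-\boldsymbol s(D))^T\,\mathrm{dVol}.$$ Let $\lambda_1(p,\varepsilon),\dots,\lambda_{n+1}(p,\varepsilon)$ be the eigenvalues, with multiplicity, of $C(V_p^+(\varepsilon))$,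 labelled so that (for small $\varepsilon$) $\lambda_{n+1}(p,\varepsilon)$, the eigenvalue of the normal direction, is the smallest, and the first $n$, the tangent eigenvalues, are ordered oppositely to the principal curvatures: $\lambda_\mu(p,\varepsilon)\ge\lambda_\nu(p,\varepsilon)$ whenever $\kappa_\mu<\kappa_\nu$. Let $V_m(\varepsilon)$ denote the volume of a ball of radius $\varepsilon$ in $\mathbb R^m$. Then for all $\mu,\nu=1,\dots,n$, $$\lim_{\varepsilon\to0^+}\frac{V_{n+1}(\varepsilon)^2}{V_n(\varepsilon)}\,\frac{\lambda_\mu(p,\varepsilon)-\lambda_\nu(p,\varepsilon)}{\lambda_\mu(p,\varepsilon)\,\lambda_\nu(p,\varepsilon)}=\frac{4(n+3)^2}{(n+2)(n+4)}\,(\kappa_\nu-\kappa_\mu).$$ -/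

import Mathlib

open Filter Topology MeasureTheory
open scoped ContDiff

/-- The Euclidean space `ℝ^m`. -/
abbrev Euc (m : ℕ) : Type := EuclideanSpace ℝ (Fin m)

/-- A smooth (embedded) hypersurface of `ℝ^m`: locally the zero set of a smooth real function
whose differential does not vanish. -/
def IsSmoothHypersurface {m : ℕ} (S : Set (Euc m)) : Prop :=
  ∀ p ∈ S, ∃ (U : Set (Euc m)) (f : Euc m → ℝ), IsOpen U ∧ p ∈ U ∧
    ContDiffOn ℝ ∞ f U ∧ (∀ q ∈ U, fderiv ℝ f q ≠ 0) ∧ S ∩ U = {q ∈ U | f q = 0}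

/-- The tangent space `T_p S`: the velocities at `p` of smooth curves lying in `S`. For a smooth
hypersurface these velocities already form a linear subspace; the span only provides the bundled
submodule. -/
def tangentSpaceAt {m : ℕ} (S : Set (Euc m)) (p : Euc m) : Submodule ℝ (Euc m) :=
  Submodule.span ℝ {v | ∃ γ : ℝ → Euc m, γ 0 = p ∧ ContDiffAt ℝ ∞ γ 0 ∧
    (∀ᶠ t in 𝓝 (0 : ℝ), γ t ∈ S) ∧ deriv γ 0 = v}

/-- `N` is a smooth unit normal vector field of `S` around `p`. A normal field on `S` near `p` is
given through a smooth extension to a neighbourhood of `p` in the ambient space; the derivatives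
of `N` in directions tangent to `S` do not depend on the extension. -/
def IsUnitNormalAround {m : ℕ} (S : Set (Euc m)) (p : Euc m) (N : Euc m → Euc m) : Prop :=
  ∃ U : Set (Euc m), IsOpen U ∧ p ∈ U ∧ ContDiffOn ℝ ∞ N U ∧
    ∀ q ∈ S ∩ U, ‖N q‖ = 1 ∧ ∀ v ∈ tangentSpaceAt S q, inner ℝ (N q) v = 0

/-- The Weingarten map (shape operator) `v ↦ -D_v N` on `T_p S`, with values written in the
ambient space. -/
noncomputable def weingartenMap {m : ℕ} (S : Set (Euc m)) (p : Euc m) (N : Euc m → Euc m) :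
    tangentSpaceAt S p →L[ℝ] Euc m :=
  -((fderiv ℝ N p).comp (tangentSpaceAt S p).subtypeL)

/-- `κ 0, …, κ (n-1)` are the principal curvatures of `S` at `p` with respect to `N`, listed with
multiplicity: the eigenvalues of the Weingarten map in an orthonormal basis of `T_p S` consisting
of principal directions. -/
def IsPrincipalCurvatures {n : ℕ} (S : Set (Euc (n + 1))) (p : Euc (n + 1))
    (N : Euc (n + 1) → Euc (n + 1)) (κ : Fin n → ℝ) : Prop :=
  ∃ e : OrthonormalBasis (Fin n) ℝ (tangentSpaceAt S p),
    ∀ μ, weingartenMap S p N (e μ) = κ μ • (e μ : Euc (n + 1))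

/-- The spherical component `V⁺_p(ε)`: the connected component of `B_p(ε) \ S` into which the
vector `ν = N(p)` points, that is, which contains `p + t ν` for all small `t > 0`. -/
def sphericalComponent {m : ℕ} (S : Set (Euc m)) (p ν : Euc m) (ε : ℝ) : Set (Euc m) :=
  {x | ∀ᶠ t in 𝓝[>] (0 : ℝ), x ∈ connectedComponentIn (Metric.closedBall p ε \ S) (p + t • ν)}

/-- The barycenter `s(D) = V(D)⁻¹ ∫_D X dVol`. -/
noncomputable def barycenter {m : ℕ} (D : Set (Euc m)) : Euc m :=
  (volume.real D)⁻¹ • ∫ x in D, x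

/-- The covariance matrix `C(D) = ∫_D (X - s(D)) ⊗ (X - s(D))ᵀ dVol`
(not normalized by the volume). -/
noncomputable def covarianceMatrix {m : ℕ} (D : Set (Euc m)) : Matrix (Fin m) (Fin m) ℝ :=
  Matrix.of fun i j => ∫ x in D, (x i - barycenter D i) * (x j - barycenter D j)

/-- `lam` lists the eigenvalues of the real symmetric matrix `C` with multiplicity: they are the
eigenvalues of an orthonormal basis of eigenvectors. -/
def IsEigenvalueList {m : ℕ} (C : Matrix (Fin m) (Fin m) ℝ) (lam : Fin m → ℝ) : Prop :=
  ∃ b : OrthonormalBasis (Fin m) ℝ (Euc m), ∀ i, Matrix.toEuclideanLin C (b i) = lam i • b i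

/-- The labelling of the eigenvalues `lam 0, …, lam n` by the principal curvatures: the last
eigenvalue, the one of the normal direction, is the smallest, and the first `n` eigenvalues, those
of the tangent directions, are ordered oppositely to the corresponding principal curvatures. -/
def IsCurvatureLabelling {n : ℕ} (κ : Fin n → ℝ) (lam : Fin (n + 1) → ℝ) : Prop :=
  (∀ μ : Fin n, lam (Fin.last n) ≤ lam μ.castSucc) ∧
    ∀ μ ν : Fin n, κ μ < κ ν → lam ν.castSucc ≤ lam μ.castSucc

/-- The volume `V_m(ε)` of a ball of radius `ε` in `ℝ^m`. -/
noncomputable def ballVolume (m : ℕ) (ε : ℝ) : ℝ :=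
  volume.real (Metric.closedBall (0 : Euc m) ε)

/-!
The eigenvalues of the covariance matrix are compared with an explicit first-order model, after
rescaling the ball of radius `ε` about `p` to the unit ball.

*Geometry.* Near `p` the hypersurface is the zero set of a function `f` with `Df(p) = ⟪N p, ·⟫`.
Differentiating the relation `Df = Df(N) ⟪N, ·⟫`, valid on `S`, along curves in `S` shows that on
tangent vectors the Hessian of `f` at `p` is the derivative of `N`, so that it is
`-∑ κᵢ yᵢ²` in principal coordinates (`exists_normalized_defining_function`). Since `f` is almost
linear near `p`, the part of a small ball where `f > 0` is star-shaped, hence it is the spherical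
component (`sphericalComponent_eq`). No graph parametrization is needed: by Taylor's formula,
`f (p + ε (y, ε t)) / ε² → t - q y` with `q y = ½ ∑ κᵢ yᵢ²`, and this determines the rescaled
component up to `o(ε)` (`isGraphRegion_superlevel`).

*Asymptotics of integrals.* If a region of the unit ball is bounded by a hypersurface asymptotic to
the graph of `ε q`, then for every continuous `g` its integral differs from the one over the upper
half ball by `-ε ∫ g(y, 0) q(y) dy + o(ε)`, the integral being over the unit ball of the tangent
space. This is dominated convergence after the substitution `z = ε t` in the normal
coordinate (`tendsto_layer_integral`). With the second and fourth moments of the ball, computed from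
its symmetries and from `∫ ‖x‖ ^ k`, it shows that the rescaled covariance matrix is, up to `o(ε)`,
block diagonal with tangent block `a - ε diag(Mᵢ)`, where `Mᵢ` is an increasing affine function of
`κᵢ`, and with a normal entry whose limit is smaller than `a`
(`IsGraphRegion.tendsto_covarianceEntry_castSucc`, `IsGraphRegion.tendsto_covarianceEntry_last`).

*Eigenvalues.* Eigenvalues labelled compatibly with the order of the model eigenvalues differ from
them by at most the size of the perturbation (`abs_eigenvalue_sub_le`, an argument of
Courant–Fischer type which is not affected by multiplicities). Hence
`λᵢ = ε ^ (n + 3) (a - ε Mᵢ + o(ε))`, and the limit follows.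
-/

/-! ### Perturbation of labelled eigenvalues -/

/-- Fewer than `dim E` linear conditions have a common nonzero solution. -/
theorem exists_ne_zero_inner_eq_zero {ι E : Type*} [Fintype ι] [DecidableEq ι]
    [NormedAddCommGroup E] [InnerProductSpace ℝ E] (b : OrthonormalBasis ι ℝ E) (i : ι)
    (w : ι → E) : ∃ x : E, x ≠ 0 ∧ ∀ j, j ≠ i → inner ℝ (w j) x = 0 := by
  have : FiniteDimensional ℝ E := b.toBasis.finiteDimensional_of_finite
  let F : E →ₗ[ℝ] ({j // j ≠ i} → ℝ) := LinearMap.pi fun j => (innerₛₗ ℝ (w j.1))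
  have hF : LinearMap.ker F ≠ ⊥ := by
    apply LinearMap.ker_ne_bot_of_finrank_lt
    rw [Module.finrank_fintype_fun_eq_card, Module.finrank_eq_card_basis b.toBasis]
    exact Fintype.card_subtype_lt (x := i) (by simp)
  obtain ⟨x, hx, hx0⟩ := Submodule.exists_mem_ne_zero_of_ne_bot hF
  refine ⟨x, hx0, fun j hj => ?_⟩
  have := congrFun (LinearMap.mem_ker.1 hx) ⟨j, hj⟩
  simpa [F] using this

theorem inner_map_self_eq_sum {ι E : Type*} [Fintype ι]
    [NormedAddCommGroup E] [InnerProductSpace ℝ E] (b : OrthonormalBasis ι ℝ E) (T : E →ₗ[ℝ] E)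
    (lam : ι → ℝ) (hT : ∀ i, T (b i) = lam i • b i) (x : E) :
    inner ℝ (T x) x = ∑ i, lam i * inner ℝ (b i) x ^ 2 := by
  conv_lhs => rw [← b.sum_repr' x, map_sum]
  rw [b.sum_repr' x, sum_inner]
  refine Finset.sum_congr rfl fun i _ => ?_
  rw [map_smul, hT, real_inner_smul_left, real_inner_smul_left]
  ring

/-- One-sided comparison. A nonzero vector is chosen orthogonal to the `b j` with `d i < d j` and
to the `b' j` with `j ≠ i` not of this kind. Its Rayleigh quotient is at least `lam i`, since all
smaller eigenvalues have been excluded by `hup`, and at most `d i + δ`. -/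
theorem eigenvalue_le_of_quadraticForm_close {ι E : Type*} [Fintype ι]
    [NormedAddCommGroup E] [InnerProductSpace ℝ E] (b b' : OrthonormalBasis ι ℝ E)
    (T : E →ₗ[ℝ] E) (lam d : ι → ℝ) (hT : ∀ i, T (b' i) = lam i • b' i) (δ : ℝ)
    (hd : ∀ x, inner ℝ (T x) x ≤ ∑ i, d i * inner ℝ (b i) x ^ 2 + δ * ‖x‖ ^ 2) (i : ι)
    (hup : ∀ j, d i < d j → lam i ≤ lam j) : lam i ≤ d i + δ := by
  classical
  obtain ⟨x, hx0, hx⟩ := exists_ne_zero_inner_eq_zero b i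
    (fun j => if d i < d j then b j else b' j)
  have h1 : lam i * ‖x‖ ^ 2 ≤ inner ℝ (T x) x := by
    rw [inner_map_self_eq_sum b' T lam hT, ← b'.sum_sq_inner_right x, Finset.mul_sum]
    refine Finset.sum_le_sum fun j _ => ?_
    by_cases h : d i < d j
    · exact mul_le_mul_of_nonneg_right (hup j h) (sq_nonneg _)
    · rcases eq_or_ne j i with rfl | hj
      · rfl
      · have := hx j hj
        rw [if_neg h] at this
        simp [this]
  have h2 : ∑ j, d j * inner ℝ (b j) x ^ 2 ≤ d i * ‖x‖ ^ 2 := by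
    rw [← b.sum_sq_inner_right x, Finset.mul_sum]
    refine Finset.sum_le_sum fun j _ => ?_
    by_cases h : d i < d j
    · have := hx j (by rintro rfl; exact lt_irrefl _ h)
      rw [if_pos h] at this
      simp [this]
    · exact mul_le_mul_of_nonneg_right (not_lt.1 h) (sq_nonneg _)
  have h3 := hd x
  have : 0 < ‖x‖ ^ 2 := by positivity
  exact le_of_mul_le_mul_right (by linarith) this

/-- If the quadratic form of `T` is `δ`-close to the diagonal form with entries `d`, and the
labelling `lam` of the eigenvalues of `T` respects the position of `d i` among the `d j`, then
`lam i` is `δ`-close to `d i`. -/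
theorem abs_eigenvalue_sub_le {ι E : Type*} [Fintype ι]
    [NormedAddCommGroup E] [InnerProductSpace ℝ E] (b b' : OrthonormalBasis ι ℝ E)
    (T : E →ₗ[ℝ] E) (lam d : ι → ℝ) (hT : ∀ i, T (b' i) = lam i • b' i) (δ : ℝ)
    (hd : ∀ x, |inner ℝ (T x) x - ∑ i, d i * inner ℝ (b i) x ^ 2| ≤ δ * ‖x‖ ^ 2) (i : ι)
    (hup : ∀ j, d i < d j → lam i ≤ lam j) (hdown : ∀ j, d j < d i → lam j ≤ lam i) :
    |lam i - d i| ≤ δ := by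
  have h1 := eigenvalue_le_of_quadraticForm_close b b' T lam d hT δ
    (fun x => by linarith [(abs_le.1 (hd x)).2]) i hup
  have h2 := eigenvalue_le_of_quadraticForm_close b b' (-T) (-lam) (-d)
    (fun i => by simp [hT]) δ
    (fun x => by
      simp only [LinearMap.neg_apply, inner_neg_left, Pi.neg_apply, neg_mul,
        Finset.sum_neg_distrib]
      linarith [(abs_le.1 (hd x)).1]) i
    (fun j h => by simpa using hdown j (by simpa using h))
  simp only [Pi.neg_apply] at h2
  exact abs_le.2 ⟨by linarith, by linarith⟩

/-! ### Integrals over a thin layer about the equator of the ball -/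

/-- The closed unit ball of the Euclidean product `F × ℝ` (whose Mathlib norm is the sup norm). -/
def prodUnitBall (F : Type*) [NormedAddCommGroup F] : Set (F × ℝ) :=
  {w | ‖w.1‖ ^ 2 + w.2 ^ 2 ≤ 1}

/-- The upper half of the unit ball of `F × ℝ`. -/
def upperHalfBall (F : Type*) [NormedAddCommGroup F] : Set (F × ℝ) :=
  prodUnitBall F ∩ {w | 0 < w.2}

section
variable {F : Type*} [NormedAddCommGroup F]

theorem isClosed_prodUnitBall : IsClosed (prodUnitBall F) :=
  isClosed_le (by fun_prop) continuous_const

theorem isCompact_prodUnitBall [NormedSpace ℝ F] [FiniteDimensional ℝ F] :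
    IsCompact (prodUnitBall F) := by
  have : ProperSpace F := FiniteDimensional.proper_real F
  refine Metric.isCompact_of_isClosed_isBounded isClosed_prodUnitBall
    ((Metric.isBounded_closedBall (x := (0 : F × ℝ)) (r := 1)).subset fun w hw => ?_)
  have hw : ‖w.1‖ ^ 2 + w.2 ^ 2 ≤ 1 := hw
  rw [mem_closedBall_zero_iff, Prod.norm_def]
  refine max_le ?_ ?_
  · nlinarith [norm_nonneg w.1, sq_nonneg w.2]
  · rw [Real.norm_eq_abs]
    exact abs_le_one_iff_mul_self_le_one.2 (by nlinarith [sq_nonneg ‖w.1‖])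

theorem measurableSet_upperHalfBall [MeasurableSpace F] [BorelSpace F]
    [SecondCountableTopology F] : MeasurableSet (upperHalfBall F) :=
  isClosed_prodUnitBall.measurableSet.inter
    (isOpen_lt continuous_const continuous_snd).measurableSet
end

/-- The signed length of the interval from `a` to `0`. -/
theorem integral_indicator_Ioi_sub (a : ℝ) :
    ∫ t : ℝ, ((Set.Ioi a).indicator 1 t - (Set.Ioi (0 : ℝ)).indicator 1 t : ℝ) = -a := by
  rcases le_total 0 a with h | h
  · have : (fun t : ℝ => ((Set.Ioi a).indicator 1 t - (Set.Ioi (0 : ℝ)).indicator 1 t : ℝ))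
        = fun t => (Set.Ioc 0 a).indicator (fun _ => (-1 : ℝ)) t := by
      funext t
      simp only [Set.indicator, Set.mem_Ioi, Set.mem_Ioc, Pi.one_apply]
      grind
    rw [this, integral_indicator measurableSet_Ioc]
    simp [h]
  · have : (fun t : ℝ => ((Set.Ioi a).indicator 1 t - (Set.Ioi (0 : ℝ)).indicator 1 t : ℝ))
        = fun t => (Set.Ioc a 0).indicator (fun _ => (1 : ℝ)) t := by
      funext t
      simp only [Set.indicator, Set.mem_Ioi, Set.mem_Ioc, Pi.one_apply]
      grind
    rw [this, integral_indicator measurableSet_Ioc]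
    simp [h]

section
variable {F : Type*} [NormedAddCommGroup F]

/-- Convergence of the integral along the normal line through a point `y` of the equator. -/
theorem tendsto_integral_fibre {q : ℝ} {K M : ℝ} {D : ℝ → Set (F × ℝ)}
    {g : F × ℝ → ℝ} (hg : Continuous g) (y : F) (hy : ‖y‖ < 1)
    (hpos : ∀ t, q < t → ∀ᶠ ε in 𝓝[>] (0 : ℝ), (y, ε * t) ∈ D ε)
    (hneg : ∀ t, t < q → ∀ᶠ ε in 𝓝[>] (0 : ℝ), (y, ε * t) ∉ D ε)
    (hmeas : ∀ᶠ ε in 𝓝[>] (0 : ℝ), AEStronglyMeasurable (fun t : ℝ => g (y, ε * t) *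
      ((D ε).indicator 1 (y, ε * t) - (upperHalfBall F).indicator 1 (y, ε * t))))
    (hbound : ∀ᶠ ε in 𝓝[>] (0 : ℝ), ∀ t : ℝ, ‖g (y, ε * t) *
      ((D ε).indicator 1 (y, ε * t) - (upperHalfBall F).indicator 1 (y, ε * t))‖ ≤
        (Set.Icc (-K) K).indicator (fun _ => M) t) :
    Tendsto (fun ε : ℝ => ∫ t : ℝ, g (y, ε * t) *
      ((D ε).indicator 1 (y, ε * t) - (upperHalfBall F).indicator 1 (y, ε * t)))
      (𝓝[>] (0 : ℝ)) (𝓝 (-(g (y, 0) * q))) := by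
  have hlim : ∫ t : ℝ, g (y, 0) *
      ((Set.Ioi q).indicator 1 t - (Set.Ioi (0 : ℝ)).indicator 1 t : ℝ) = -(g (y, 0) * q) := by
    rw [integral_const_mul, integral_indicator_Ioi_sub]
    ring
  rw [← hlim]
  refine tendsto_integral_filter_of_dominated_convergence _ hmeas
    (hbound.mono fun ε h => Eventually.of_forall h) ?_ ?_
  · rw [integrable_indicator_iff measurableSet_Icc]
    exact integrableOn_const (by simp)
  have hne : ∀ᵐ t : ℝ, t ≠ q ∧ t ≠ 0 := by
    have h1 : ∀ᵐ t : ℝ, t ≠ q := by simp [ae_iff]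
    have h2 : ∀ᵐ t : ℝ, t ≠ 0 := by simp [ae_iff]
    exact h1.and h2
  filter_upwards [hne] with t ht
  have hε : Tendsto (fun ε : ℝ => ε * t) (𝓝[>] 0) (𝓝 0) := by
    have : Tendsto (fun ε : ℝ => ε * t) (𝓝 0) (𝓝 (0 * t)) := by
      exact (continuous_id.mul continuous_const).tendsto 0
    rw [zero_mul] at this
    exact this.mono_left nhdsWithin_le_nhds
  refine Tendsto.mul ((hg.tendsto (y, 0)).comp (tendsto_const_nhds.prodMk_nhds hε)) ?_
  refine Tendsto.sub ?_ ?_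
  · rcases lt_or_gt_of_ne ht.1 with h | h
    · refine tendsto_const_nhds.congr' ?_
      filter_upwards [hneg t h] with ε hε
      rw [Set.indicator_of_notMem hε, Set.indicator_of_notMem (by simpa using h.le)]
    · refine tendsto_const_nhds.congr' ?_
      filter_upwards [hpos t h] with ε hε
      rw [Set.indicator_of_mem hε, Set.indicator_of_mem (by simpa using h)]
      rfl
  · have hball : ∀ᶠ ε in 𝓝[>] (0 : ℝ), ‖y‖ ^ 2 + (ε * t) ^ 2 < 1 := by
      have : Tendsto (fun ε : ℝ => ‖y‖ ^ 2 + (ε * t) ^ 2) (𝓝[>] 0) (𝓝 (‖y‖ ^ 2 + 0 ^ 2)) :=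
        tendsto_const_nhds.add (hε.pow 2)
      refine this.eventually_lt_const ?_
      nlinarith [norm_nonneg y]
    refine tendsto_const_nhds.congr' ?_
    filter_upwards [hball, self_mem_nhdsWithin] with ε h1 (h2 : 0 < ε)
    by_cases h : 0 < t
    · rw [Set.indicator_of_mem (show (y, ε * t) ∈ upperHalfBall F from
        ⟨h1.le, mul_pos h2 h⟩), Set.indicator_of_mem (by simpa using h)]
      rfl
    · rw [Set.indicator_of_notMem (fun h' : (y, ε * t) ∈ upperHalfBall F =>
        h ((mul_pos_iff_of_pos_left h2).1 h'.2)), Set.indicator_of_notMem (by simpa using h)]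

variable [NormedSpace ℝ F] [FiniteDimensional ℝ F] [MeasureSpace F] [BorelSpace F]
  [Measure.IsAddHaarMeasure (volume : Measure F)]

/-- Let `D ε` be regions of the unit ball of `F × ℝ` which are, in the coordinates `(y, t)` with
`z = ε t`, asymptotically given by `t > q y`, and which agree with the upper half ball at heights
beyond `K ε`. This is the first-order expansion of integrals over `D ε`. -/
theorem tendsto_layer_integral {q : F → ℝ} {K : ℝ} (hK0 : 0 ≤ K) {D : ℝ → Set (F × ℝ)}
    (hDm : ∀ᶠ ε in 𝓝[>] (0 : ℝ), MeasurableSet (D ε))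
    (hDB : ∀ᶠ ε in 𝓝[>] (0 : ℝ), D ε ⊆ prodUnitBall F)
    (hpos : ∀ y t, ‖y‖ < 1 → q y < t → ∀ᶠ ε in 𝓝[>] (0 : ℝ), (y, ε * t) ∈ D ε)
    (hneg : ∀ y t, ‖y‖ < 1 → t < q y → ∀ᶠ ε in 𝓝[>] (0 : ℝ), (y, ε * t) ∉ D ε)
    (hK : ∀ᶠ ε in 𝓝[>] (0 : ℝ), ∀ w ∈ prodUnitBall F,
      (K * ε < w.2 → w ∈ D ε) ∧ (w.2 < -(K * ε) → w ∉ D ε))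
    {g : F × ℝ → ℝ} (hg : Continuous g) :
    Tendsto (fun ε : ℝ => ε⁻¹ * ((∫ w in D ε, g w) - ∫ w in upperHalfBall F, g w))
      (𝓝[>] (0 : ℝ)) (𝓝 (-∫ y in Metric.closedBall (0 : F) 1, g (y, 0) * q y)) := by
  have : ProperSpace F := FiniteDimensional.proper_real F
  have : SecondCountableTopology F := secondCountable_of_proper
  obtain ⟨M, hM⟩ := isCompact_prodUnitBall.exists_bound_of_continuousOn
    (hg.continuousOn (s := prodUnitBall F))
  have hM0 : 0 ≤ M := (norm_nonneg _).trans (hM 0 (by simp [prodUnitBall]))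
  have hgB : IntegrableOn g (prodUnitBall F) :=
    hg.continuousOn.integrableOn_compact isCompact_prodUnitBall
  set H := upperHalfBall F with hH
  have hHB : H ⊆ prodUnitBall F := Set.inter_subset_left
  have hHm : MeasurableSet H := measurableSet_upperHalfBall
  let h : ℝ → F × ℝ → ℝ := fun ε w => g w * ((D ε).indicator 1 w - H.indicator 1 w)
  have hh : ∀ ε, h ε = fun w => (D ε).indicator g w - H.indicator g w := by
    intro ε
    funext w
    simp only [h, mul_sub, Set.indicator, Pi.one_apply]
    split_ifs <;> simp
  have hint : ∀ᶠ ε in 𝓝[>] (0 : ℝ), Integrable (h ε) := by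
    filter_upwards [hDm, hDB] with ε h1 h2
    rw [hh]
    exact ((integrable_indicator_iff h1).2 (hgB.mono_set h2)).sub
      ((integrable_indicator_iff hHm).2 (hgB.mono_set hHB))
  -- the integrand lives on a layer of thickness `O(ε)` about the equator
  have hb : ∀ᶠ ε in 𝓝[>] (0 : ℝ), ∀ (y : F) (t : ℝ), ‖h ε (y, ε * t)‖ ≤
      (Metric.closedBall (0 : F) 1).indicator
        (fun _ => (Set.Icc (-K) K).indicator (fun _ => M) t) y := by
    filter_upwards [hDB, hK, self_mem_nhdsWithin] with ε h1 h2 (h3 : 0 < ε) y t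
    by_cases hw : (y, ε * t) ∈ prodUnitBall F
    · have hy : y ∈ Metric.closedBall (0 : F) 1 := by
        have hw : ‖y‖ ^ 2 + (ε * t) ^ 2 ≤ 1 := hw
        rw [mem_closedBall_zero_iff]
        nlinarith [norm_nonneg y, sq_nonneg (ε * t)]
      rw [Set.indicator_of_mem hy]
      by_cases ht : t ∈ Set.Icc (-K) K
      · rw [Set.indicator_of_mem ht]
        have := hM _ hw
        simp only [h, norm_mul, Set.indicator, Pi.one_apply]
        rw [Real.norm_eq_abs] at this ⊢
        split_ifs <;> simp <;> first | exact hM0 | exact this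
      · rw [Set.indicator_of_notMem ht]
        have : h ε (y, ε * t) = 0 := by
          rw [Set.mem_Icc, not_and_or, not_le, not_le] at ht
          rcases ht with ht | ht
          · have hD : (y, ε * t) ∉ D ε := (h2 _ hw).2 (by simp only; nlinarith)
            have hH' : (y, ε * t) ∉ H := fun h' => by
              have : 0 < ε * t := h'.2
              nlinarith
            simp [h, hD, hH']
          · have hD : (y, ε * t) ∈ D ε := (h2 _ hw).1 (by simp only; nlinarith)
            have hH' : (y, ε * t) ∈ H := ⟨hw, mul_pos h3 (hK0.trans_lt ht)⟩
            simp [h, hD, hH']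
        simp [this]
    · have : h ε (y, ε * t) = 0 := by
        simp [h, Set.indicator_of_notMem (fun h' => hw (h1 h')),
          Set.indicator_of_notMem (fun h' => hw (hHB h'))]
      rw [this, norm_zero]
      refine Set.indicator_nonneg (fun _ _ => Set.indicator_nonneg (fun _ _ => ?_) _) _
      positivity
  -- rescale the normal coordinate by `ε`
  have hkey : ∀ᶠ ε in 𝓝[>] (0 : ℝ), ∀ y, ∫ t : ℝ, h ε (y, ε * t) = ε⁻¹ * ∫ z, h ε (y, z) := by
    filter_upwards [self_mem_nhdsWithin] with ε (h3 : 0 < ε) y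
    rw [Measure.integral_comp_mul_left (fun z => h ε (y, z)) ε, abs_of_pos (inv_pos.2 h3),
      smul_eq_mul]
  have heq : ∀ᶠ ε in 𝓝[>] (0 : ℝ), ∫ y, ∫ t : ℝ, h ε (y, ε * t) =
      ε⁻¹ * ((∫ w in D ε, g w) - ∫ w in H, g w) := by
    filter_upwards [hkey, hint, hDm, hDB] with ε h1 h2 h3 h4
    simp_rw [h1]
    rw [integral_const_mul, ← integral_prod _ h2]
    congr 1
    rw [hh, ← Measure.volume_eq_prod]
    simp only
    rw [integral_sub ((integrable_indicator_iff h3).2 (hgB.mono_set h4))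
      ((integrable_indicator_iff hHm).2 (hgB.mono_set hHB)), integral_indicator h3,
      integral_indicator hHm]
  refine Tendsto.congr' heq ?_
  rw [← integral_neg, ← integral_indicator measurableSet_closedBall]
  refine tendsto_integral_filter_of_dominated_convergence
    ((Metric.closedBall (0 : F) 1).indicator fun _ => ∫ t : ℝ, (Set.Icc (-K) K).indicator
      (fun _ => M) t) ?_ ?_ ?_ ?_
  · filter_upwards [hkey, hint] with ε h1 h2
    simp_rw [h1]
    exact h2.integral_prod_left.aestronglyMeasurable.const_mul _
  · filter_upwards [hb] with ε h1
    refine Eventually.of_forall fun y => ?_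
    by_cases hy : y ∈ Metric.closedBall (0 : F) 1
    · rw [Set.indicator_of_mem hy]
      refine norm_integral_le_of_norm_le ?_ (Eventually.of_forall fun t => ?_)
      · rw [integrable_indicator_iff measurableSet_Icc]
        exact integrableOn_const (by simp)
      · simpa [hy] using h1 y t
    · have : ∀ t, h ε (y, ε * t) = 0 := fun t => by
        have := h1 y t
        rw [Set.indicator_of_notMem hy] at this
        exact norm_le_zero_iff.1 this
      simp [this, hy]
  · rw [integrable_indicator_iff measurableSet_closedBall]
    exact integrableOn_const measure_closedBall_lt_top.ne
  · have hs : ∀ᵐ y : F, y ∉ Metric.sphere (0 : F) 1 :=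
      measure_eq_zero_iff_ae_notMem.1
        (Measure.addHaar_sphere_of_ne_zero volume (0 : F) one_ne_zero)
    filter_upwards [hs] with y hy
    rw [mem_sphere_zero_iff_norm] at hy
    rcases lt_or_gt_of_ne hy with hy | hy
    · rw [Set.indicator_of_mem (by simpa using hy.le)]
      refine tendsto_integral_fibre (K := K) (M := M) hg y hy (fun t => hpos y t hy)
        (fun t => hneg y t hy) ?_ ?_
      · filter_upwards [hDm] with ε h1
        have hm : Measurable fun t : ℝ => (y, ε * t) := by fun_prop
        refine ((hg.measurable.comp hm).mul ?_).aestronglyMeasurable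
        exact ((measurable_one.indicator h1).comp hm).sub
          ((measurable_one.indicator hHm).comp hm)
      · filter_upwards [hb] with ε h1 t
        have := h1 y t
        rwa [Set.indicator_of_mem (by simpa using hy.le)] at this
    · rw [Set.indicator_of_notMem (by simpa using hy)]
      refine tendsto_const_nhds.congr' ?_
      filter_upwards [hb] with ε h1
      have : ∀ t, h ε (y, ε * t) = 0 := fun t => by
        have := h1 y t
        rw [Set.indicator_of_notMem (by simpa using hy)] at this
        exact norm_le_zero_iff.1 this
      simp [this]
end

/-! ### Moments of the unit ball -/

section
variable {E : Type*} [NormedAddCommGroup E] [InnerProductSpace ℝ E]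

theorem linearIsometryEquiv_preimage_closedBall (L : E ≃ₗᵢ[ℝ] E) :
    L ⁻¹' Metric.closedBall (0 : E) 1 = Metric.closedBall 0 1 := by
  ext x
  simp

theorem inner_reflection_orthogonal_self (u x : E) :
    inner ℝ u ((ℝ ∙ u)ᗮ.reflection x) = -inner ℝ u x := by
  rw [← LinearIsometryEquiv.inner_map_map ((ℝ ∙ u)ᗮ.reflection) u x,
    Submodule.reflection_orthogonalComplement_singleton_eq_neg, inner_neg_left, neg_neg]

theorem inner_reflection_orthogonal_of_inner_eq_zero {u v : E} (h : inner ℝ u v = 0) (x : E) :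
    inner ℝ v ((ℝ ∙ u)ᗮ.reflection x) = inner ℝ v x := by
  rw [← LinearIsometryEquiv.inner_map_map ((ℝ ∙ u)ᗮ.reflection) v x,
    (Submodule.reflection_eq_self_iff v).2 (Submodule.mem_orthogonal_singleton_iff_inner_right.2 h)]
end

section
variable {E : Type*} [NormedAddCommGroup E] [InnerProductSpace ℝ E] [FiniteDimensional ℝ E]
  [MeasurableSpace E] [BorelSpace E]

theorem integral_closedBall_norm_pow [Nontrivial E] (k : ℕ) :
    ∫ x in Metric.closedBall (0 : E) 1, ‖x‖ ^ k = Module.finrank ℝ E *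
      volume.real (Metric.closedBall (0 : E) 1) / (Module.finrank ℝ E + k) := by
  rw [← integral_indicator measurableSet_closedBall]
  have h1 : (Metric.closedBall (0 : E) 1).indicator (fun x => ‖x‖ ^ k) =
      fun x => (Set.Iic (1 : ℝ)).indicator (fun r => r ^ k) ‖x‖ := by
    funext x
    simp [Set.indicator]
  have hm : 0 < Module.finrank ℝ E := Module.finrank_pos
  rw [h1, integral_fun_norm_addHaar volume, smul_eq_mul, nsmul_eq_mul]
  have h2 : ∫ y in Set.Ioi (0 : ℝ), y ^ (Module.finrank ℝ E - 1) •
      (Set.Iic (1 : ℝ)).indicator (fun r => r ^ k) y = 1 / (Module.finrank ℝ E + k) := by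
    have h3 : (fun y : ℝ => y ^ (Module.finrank ℝ E - 1) •
        (Set.Iic (1 : ℝ)).indicator (fun r => r ^ k) y) =
        (Set.Iic (1 : ℝ)).indicator fun y => y ^ (Module.finrank ℝ E - 1 + k) := by
      funext y
      simp only [Set.indicator, smul_eq_mul]
      split_ifs
      · rw [pow_add]
      · simp
    rw [h3, setIntegral_indicator measurableSet_Iic, Set.Ioi_inter_Iic,
      ← intervalIntegral.integral_of_le zero_le_one, integral_pow]
    have : ((Module.finrank ℝ E - 1 + k : ℕ) : ℝ) + 1 = Module.finrank ℝ E + k := by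
      norm_cast
      omega
    rw [this]
    simp
  rw [h2, measureReal_def, measureReal_def, Measure.addHaar_closedBall_eq_addHaar_ball]
  ring

theorem setIntegral_comp_linearIsometryEquiv (L : E ≃ₗᵢ[ℝ] E) {s t : Set E} (h : L ⁻¹' s = t)
    (G : E → ℝ) : ∫ x in t, G (L x) = ∫ x in s, G x := by
  rw [← h]
  exact L.measurePreserving.setIntegral_preimage_emb L.toMeasurableEquiv.measurableEmbedding G s

theorem integrableOn_closedBall {G : E → ℝ} (hG : Continuous G) :
    IntegrableOn G (Metric.closedBall (0 : E) 1) :=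
  hG.continuousOn.integrableOn_compact (isCompact_closedBall _ _)

/-- Integrals over a set that is symmetric under the reflection in `uᗮ` vanish on odd functions. -/
theorem setIntegral_eq_zero_of_reflection (u : E) {s : Set E} {G : E → ℝ}
    (hs : ∀ x, (ℝ ∙ u)ᗮ.reflection x ∈ s ↔ x ∈ s)
    (hG : ∀ x, G ((ℝ ∙ u)ᗮ.reflection x) = -G x) : ∫ x in s, G x = 0 := by
  have := setIntegral_comp_linearIsometryEquiv ((ℝ ∙ u)ᗮ.reflection) (s := s) (t := s)
    (by ext x; exact hs x) G
  simp_rw [hG, integral_neg] at this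
  linarith

/-- Moments depend only on the length of the direction: a reflection exchanges `u` and `v`. -/
theorem integral_closedBall_inner_pow_eq {u v : E} (h : ‖u‖ = ‖v‖) (k : ℕ) :
    ∫ x in Metric.closedBall (0 : E) 1, inner ℝ u x ^ k =
      ∫ x in Metric.closedBall (0 : E) 1, inner ℝ v x ^ k := by
  have h1 := setIntegral_comp_linearIsometryEquiv ((ℝ ∙ (u - v))ᗮ.reflection)
    (linearIsometryEquiv_preimage_closedBall _) (fun x => inner ℝ v x ^ k)
  rw [← h1]
  congr 1
  funext x
  rw [← LinearIsometryEquiv.inner_map_map ((ℝ ∙ (u - v))ᗮ.reflection) u x,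
    Submodule.reflection_sub h]

theorem integral_closedBall_inner_sq {ι : Type*} [Fintype ι] (b : OrthonormalBasis ι ℝ E) (i : ι) :
    ∫ x in Metric.closedBall (0 : E) 1, inner ℝ (b i) x ^ 2 =
      volume.real (Metric.closedBall (0 : E) 1) / (Fintype.card ι + 2) := by
  have hn : Nontrivial E := ⟨b i, 0, b.orthonormal.ne_zero i⟩
  have hc : Module.finrank ℝ E = Fintype.card ι := Module.finrank_eq_card_basis b.toBasis
  have h1 := integral_closedBall_norm_pow (E := E) 2
  simp_rw [← b.sum_sq_inner_right] at h1
  rw [integral_finsetSum _ fun j _ => integrableOn_closedBall (by fun_prop),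
    Finset.sum_congr rfl fun j _ => integral_closedBall_inner_pow_eq
      (show ‖b j‖ = ‖b i‖ by simp) 2, Finset.sum_const, hc, nsmul_eq_mul, Finset.card_univ] at h1
  have : (0 : ℝ) < Fintype.card ι := by
    have := Fintype.card_pos_iff.2 ⟨i⟩
    exact_mod_cast this
  push_cast at h1
  field_simp at h1 ⊢
  linarith

/-- Apply the rotation invariance to the unit vectors `(b i ± b j) / √2`. -/
theorem integral_closedBall_inner_pow_four {ι : Type*} [Fintype ι] (b : OrthonormalBasis ι ℝ E)
    {i j : ι} (hij : i ≠ j) :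
    ∫ x in Metric.closedBall (0 : E) 1, inner ℝ (b i) x ^ 4 =
      3 * ∫ x in Metric.closedBall (0 : E) 1, inner ℝ (b i) x ^ 2 * inner ℝ (b j) x ^ 2 := by
  have hb : inner ℝ (b i) (b j) = 0 := b.orthonormal.2 hij
  have h2 : ‖(√2 : ℝ) • b i‖ = √2 := by simp [norm_smul]
  have hp : ‖b i + b j‖ = √2 := by
    rw [eq_comm, Real.sqrt_eq_iff_mul_self_eq (by norm_num) (norm_nonneg _),
      norm_add_mul_self_real, hb]
    norm_num
  have hm : ‖b i - b j‖ = √2 := by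
    rw [eq_comm, Real.sqrt_eq_iff_mul_self_eq (by norm_num) (norm_nonneg _),
      norm_sub_mul_self_real, hb]
    norm_num
  have e1 := integral_closedBall_inner_pow_eq (hp.trans h2.symm) 4
  have e2 := integral_closedBall_inner_pow_eq (hm.trans h2.symm) 4
  have e3 := integral_closedBall_inner_pow_eq (show ‖b j‖ = ‖b i‖ by simp) 4
  have h4 : (√2 : ℝ) ^ 4 = 4 := by
    rw [show (√2 : ℝ) ^ 4 = (√2 ^ 2) ^ 2 by ring, Real.sq_sqrt (by norm_num)]
    norm_num
  simp_rw [real_inner_smul_left, mul_pow, h4] at e1 e2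
  rw [integral_const_mul] at e1 e2
  have e4 : (∫ x in Metric.closedBall (0 : E) 1, inner ℝ (b i + b j) x ^ 4) +
      ∫ x in Metric.closedBall (0 : E) 1, inner ℝ (b i - b j) x ^ 4 =
      2 * (∫ x in Metric.closedBall (0 : E) 1, inner ℝ (b i) x ^ 4) +
      2 * (∫ x in Metric.closedBall (0 : E) 1, inner ℝ (b j) x ^ 4) +
      12 * ∫ x in Metric.closedBall (0 : E) 1, inner ℝ (b i) x ^ 2 * inner ℝ (b j) x ^ 2 := by
    rw [← integral_const_mul, ← integral_const_mul, ← integral_const_mul, ← integral_add,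
      ← integral_add, ← integral_add]
    · congr 1
      funext x
      rw [inner_add_left, inner_sub_left]
      ring
    all_goals exact integrableOn_closedBall (by fun_prop)
  linarith

theorem integral_closedBall_inner_sq_mul_inner_sq {ι : Type*} [Fintype ι] [DecidableEq ι]
    (b : OrthonormalBasis ι ℝ E) (i j : ι) :
    ∫ x in Metric.closedBall (0 : E) 1, inner ℝ (b i) x ^ 2 * inner ℝ (b j) x ^ 2 =
      volume.real (Metric.closedBall (0 : E) 1) /
        ((Fintype.card ι + 2) * (Fintype.card ι + 4)) * if i = j then 3 else 1 := by
  have hn : Nontrivial E := ⟨b i, 0, b.orthonormal.ne_zero i⟩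
  have hc : Module.finrank ℝ E = Fintype.card ι := Module.finrank_eq_card_basis b.toBasis
  obtain ⟨I, hI⟩ : ∃ I, ∫ x in Metric.closedBall (0 : E) 1, inner ℝ (b i) x ^ 4 = 3 * I :=
    ⟨_, (mul_div_cancel₀ _ (by norm_num)).symm⟩
  have h4 : ∀ k, ∫ x in Metric.closedBall (0 : E) 1, inner ℝ (b k) x ^ 4 = 3 * I := fun k => by
    rw [← hI]
    exact integral_closedBall_inner_pow_eq (by simp) 4
  have h22 : ∀ k l, ∫ x in Metric.closedBall (0 : E) 1,
      inner ℝ (b k) x ^ 2 * inner ℝ (b l) x ^ 2 = I + if k = l then 2 * I else 0 := by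
    intro k l
    by_cases hkl : k = l
    · subst hkl
      simp_rw [← pow_add]
      rw [h4]
      simp only [if_true]
      ring
    · have := integral_closedBall_inner_pow_four b hkl
      rw [h4] at this
      rw [if_neg hkl]
      linarith
  -- the fourth moments are all determined by `∫ ‖x‖ ^ 4`
  have h1 := integral_closedBall_norm_pow (E := E) 4
  have h5 : ∀ x : E, ‖x‖ ^ 4 = ∑ k, ∑ l, inner ℝ (b k) x ^ 2 * inner ℝ (b l) x ^ 2 := fun x => by
    rw [← Finset.sum_mul_sum, b.sum_sq_inner_right]
    ring
  simp_rw [h5] at h1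
  rw [integral_finsetSum _ fun k _ => integrableOn_closedBall (by fun_prop)] at h1
  have h6 : ∀ k, ∫ x in Metric.closedBall (0 : E) 1,
      ∑ l, inner ℝ (b k) x ^ 2 * inner ℝ (b l) x ^ 2 =
        ∑ l, (I + if k = l then 2 * I else 0) := fun k => by
    rw [integral_finsetSum _ fun l _ => integrableOn_closedBall (by fun_prop)]
    exact Finset.sum_congr rfl fun l _ => h22 k l
  simp_rw [h6] at h1
  simp only [Finset.sum_add_distrib, Finset.sum_const, Finset.sum_ite_eq, Finset.mem_univ,
    if_true, Finset.card_univ, nsmul_eq_mul, hc] at h1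
  have : (0 : ℝ) < Fintype.card ι := by
    have := Fintype.card_pos_iff.2 ⟨i⟩
    exact_mod_cast this
  have h7 : I = volume.real (Metric.closedBall (0 : E) 1) /
      ((Fintype.card ι + 2) * (Fintype.card ι + 4)) := by
    push_cast at h1
    field_simp at h1 ⊢
    linarith
  rw [h22, h7]
  split_ifs <;> ring
end

/-! ### Graph coordinates and half balls -/

section
variable {E : Type*} [NormedAddCommGroup E] [InnerProductSpace ℝ E]
  [MeasurableSpace E] [BorelSpace E] {n : ℕ}

/-- The coordinates `(y, t) ↦ ∑ yᵢ bᵢ + t bₙ` of `E` adapted to an orthonormal basis `b`, the last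
vector of which plays the role of the normal direction. -/
noncomputable def graphCoord (b : OrthonormalBasis (Fin (n + 1)) ℝ E) : Euc n × ℝ ≃ᵐ E :=
  (((MeasurableEquiv.toLp 2 (Fin n → ℝ)).symm.prodCongr (MeasurableEquiv.refl ℝ)).trans
    MeasurableEquiv.prodComm).trans
    (((MeasurableEquiv.piFinSuccAbove (fun _ => ℝ) (Fin.last n)).symm.trans
      (MeasurableEquiv.toLp 2 (Fin (n + 1) → ℝ))).trans b.repr.symm.toMeasurableEquiv)

variable (b : OrthonormalBasis (Fin (n + 1)) ℝ E)

theorem inner_castSucc_graphCoord (w : Euc n × ℝ) (i : Fin n) :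
    inner ℝ (b i.castSucc) (graphCoord b w) = w.1 i := by
  rw [← b.repr_apply_apply]
  have : b.repr (graphCoord b w) = WithLp.toLp 2 (Fin.insertNth (Fin.last n) w.2 w.1) :=
    b.repr.apply_symm_apply _
  rw [this]
  simp

theorem inner_last_graphCoord (w : Euc n × ℝ) :
    inner ℝ (b (Fin.last n)) (graphCoord b w) = w.2 := by
  rw [← b.repr_apply_apply]
  have : b.repr (graphCoord b w) = WithLp.toLp 2 (Fin.insertNth (Fin.last n) w.2 w.1) :=
    b.repr.apply_symm_apply _
  rw [this]
  simp

theorem norm_sq_graphCoord (w : Euc n × ℝ) :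
    ‖graphCoord b w‖ ^ 2 = ‖w.1‖ ^ 2 + w.2 ^ 2 := by
  rw [← b.sum_sq_inner_right, Fin.sum_univ_castSucc, inner_last_graphCoord,
    EuclideanSpace.real_norm_sq_eq]
  simp_rw [inner_castSucc_graphCoord]

theorem graphCoord_eq (w : Euc n × ℝ) :
    graphCoord b w = ∑ i, w.1 i • b i.castSucc + w.2 • b (Fin.last n) := by
  rw [← b.sum_repr' (graphCoord b w), Fin.sum_univ_castSucc, inner_last_graphCoord]
  simp_rw [inner_castSucc_graphCoord]

theorem continuous_graphCoord : Continuous (graphCoord b) := by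
  have : ⇑(graphCoord b) = fun w => ∑ i, w.1 i • b i.castSucc + w.2 • b (Fin.last n) :=
    funext (graphCoord_eq b)
  rw [this]
  fun_prop

/-- The half `{x | ‖x‖ ≤ 1, 0 < ⟪ν, x⟫}` of the closed unit ball. -/
def halfBall (ν : E) : Set E := Metric.closedBall 0 1 ∩ {x | 0 < inner ℝ ν x}

theorem measurableSet_halfBall (ν : E) : MeasurableSet (halfBall ν) :=
  measurableSet_closedBall.inter (isOpen_lt continuous_const (by fun_prop)).measurableSet

theorem graphCoord_preimage_closedBall :
    graphCoord b ⁻¹' Metric.closedBall 0 1 = prodUnitBall (Euc n) := by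
  ext w
  rw [Set.mem_preimage, mem_closedBall_zero_iff, ← sq_le_one_iff₀ (norm_nonneg _),
    norm_sq_graphCoord]
  rfl

theorem graphCoord_preimage_halfBall :
    graphCoord b ⁻¹' halfBall (b (Fin.last n)) = upperHalfBall (Euc n) := by
  rw [halfBall, Set.preimage_inter, graphCoord_preimage_closedBall, upperHalfBall]
  congr 1
  ext w
  simp [inner_last_graphCoord]

/-- `D ε` is the part of the unit ball above a hypersurface which is asymptotic, as `ε → 0`, to the
graph of `ε q` over the hyperplane spanned by the first `n` vectors of `b`. -/
structure IsGraphRegion (q : Euc n → ℝ) (D : ℝ → Set E) : Prop where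
  measurable : ∀ᶠ ε in 𝓝[>] (0 : ℝ), MeasurableSet (D ε)
  subset : ∀ᶠ ε in 𝓝[>] (0 : ℝ), D ε ⊆ Metric.closedBall 0 1
  above : ∀ y t, ‖y‖ < 1 → q y < t → ∀ᶠ ε in 𝓝[>] (0 : ℝ), graphCoord b (y, ε * t) ∈ D ε
  below : ∀ y t, ‖y‖ < 1 → t < q y → ∀ᶠ ε in 𝓝[>] (0 : ℝ), graphCoord b (y, ε * t) ∉ D ε
  layer : ∃ K : ℝ, 0 ≤ K ∧ ∀ᶠ ε in 𝓝[>] (0 : ℝ), ∀ x ∈ Metric.closedBall (0 : E) 1,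
    (K * ε < inner ℝ (b (Fin.last n)) x → x ∈ D ε) ∧
      (inner ℝ (b (Fin.last n)) x < -(K * ε) → x ∉ D ε)

variable [FiniteDimensional ℝ E]

theorem measurePreserving_graphCoord : MeasurePreserving (graphCoord b) := by
  have h1 : MeasurePreserving ((MeasurableEquiv.toLp 2 (Fin n → ℝ)).symm.prodCongr
      (MeasurableEquiv.refl ℝ)) :=
    (EuclideanSpace.volume_preserving_symm_measurableEquiv_toLp (Fin n)).prod
      (MeasurePreserving.id volume)
  have h2 : MeasurePreserving (MeasurableEquiv.prodComm : (Fin n → ℝ) × ℝ ≃ᵐ ℝ × (Fin n → ℝ)) :=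
    Measure.measurePreserving_swap
  have h3 := (volume_preserving_piFinSuccAbove (fun _ : Fin (n + 1) => ℝ) (Fin.last n)).symm
  have h4 := (EuclideanSpace.volume_preserving_symm_measurableEquiv_toLp (Fin (n + 1))).symm
  exact (b.measurePreserving_repr_symm.comp (h4.comp h3)).comp (h2.comp h1)

variable {b} {q : Euc n → ℝ} {D : ℝ → Set E}

/-- The first-order expansion of `tendsto_layer_integral` in the coordinates of the basis `b`. -/
theorem IsGraphRegion.tendsto_integral_sub (h : IsGraphRegion b q D) {G : E → ℝ}
    (hG : Continuous G) :
    Tendsto (fun ε : ℝ => ε⁻¹ * ((∫ x in D ε, G x) - ∫ x in halfBall (b (Fin.last n)), G x))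
      (𝓝[>] (0 : ℝ))
      (𝓝 (-∫ y in Metric.closedBall (0 : Euc n) 1, G (graphCoord b (y, 0)) * q y)) := by
  obtain ⟨K, hK0, hK⟩ := h.layer
  have key := tendsto_layer_integral (q := q) hK0 (D := fun ε => graphCoord b ⁻¹' D ε)
    (h.measurable.mono fun ε hε => (graphCoord b).measurable hε)
    (h.subset.mono fun ε hε => by
      rw [← graphCoord_preimage_closedBall b]
      exact Set.preimage_mono hε) h.above h.below
    (hK.mono fun ε hε w hw => by
      rw [← graphCoord_preimage_closedBall b] at hw
      have := hε _ hw
      rwa [inner_last_graphCoord] at this) (hG.comp (continuous_graphCoord b))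
  refine key.congr fun ε => ?_
  simp only [Function.comp_apply]
  rw [← graphCoord_preimage_halfBall b,
    (measurePreserving_graphCoord b).setIntegral_preimage_emb (graphCoord b).measurableEmbedding G,
    (measurePreserving_graphCoord b).setIntegral_preimage_emb (graphCoord b).measurableEmbedding G]

theorem IsGraphRegion.tendsto_integral (h : IsGraphRegion b q D) {G : E → ℝ}
    (hG : Continuous G) :
    Tendsto (fun ε : ℝ => ∫ x in D ε, G x) (𝓝[>] (0 : ℝ))
      (𝓝 (∫ x in halfBall (b (Fin.last n)), G x)) := by
  have hε : Tendsto (fun ε : ℝ => ε) (𝓝[>] 0) (𝓝 0) := nhdsWithin_le_nhds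
  have := (hε.mul (h.tendsto_integral_sub hG)).add_const (∫ x in halfBall (b (Fin.last n)), G x)
  rw [zero_mul, zero_add] at this
  refine this.congr' ?_
  filter_upwards [self_mem_nhdsWithin] with ε (hε : 0 < ε)
  rw [mul_inv_cancel_left₀ hε.ne']
  ring

theorem integrableOn_halfBall (ν : E) {G : E → ℝ} (hG : Continuous G) :
    IntegrableOn G (halfBall ν) :=
  (integrableOn_closedBall hG).mono_set Set.inter_subset_left

/-- Functions that are even in the normal direction have half of their integral on each side. -/
theorem integral_halfBall_of_even {ν : E} (hν : ν ≠ 0) {G : E → ℝ} (hG : Continuous G)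
    (heven : ∀ x, G ((ℝ ∙ ν)ᗮ.reflection x) = G x) :
    ∫ x in halfBall ν, G x = (∫ x in Metric.closedBall (0 : E) 1, G x) / 2 := by
  have hneg : ∫ x in halfBall (-ν), G x = ∫ x in halfBall ν, G x := by
    rw [← setIntegral_comp_linearIsometryEquiv ((ℝ ∙ ν)ᗮ.reflection) (s := halfBall ν)
      (t := halfBall (-ν)) _ G]
    · simp_rw [heven]
    · ext x
      simp [halfBall, inner_reflection_orthogonal_self]
  have hnull : volume {x : E | inner ℝ ν x = 0} = 0 := by
    have := Measure.addHaar_submodule volume (LinearMap.ker (innerₛₗ ℝ ν)) (by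
      intro htop
      have : ν ∈ LinearMap.ker (innerₛₗ ℝ ν) := htop ▸ Submodule.mem_top
      exact hν (by simpa using this))
    exact this
  have hdisj : Disjoint (halfBall ν) (halfBall (-ν)) := by
    rw [Set.disjoint_left]
    rintro x ⟨-, h1⟩ ⟨-, h2⟩
    simp only [Set.mem_ofPred_eq, inner_neg_left] at h1 h2
    linarith
  have hae : (Metric.closedBall (0 : E) 1 : Set E) =ᵐ[volume]
      (halfBall ν ∪ halfBall (-ν) : Set E) := by
    filter_upwards [measure_eq_zero_iff_ae_notMem.1 hnull] with x hx
    have hx : inner ℝ ν x ≠ 0 := hx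
    apply propext
    change x ∈ Metric.closedBall (0 : E) 1 ↔ x ∈ halfBall ν ∪ halfBall (-ν)
    simp only [halfBall, Set.mem_union, Set.mem_inter_iff, Set.mem_ofPred_eq, inner_neg_left,
      Left.neg_pos_iff, ← and_or_left, lt_or_lt_iff_ne]
    simp [hx.symm]
  rw [setIntegral_congr_set hae, setIntegral_union hdisj (measurableSet_halfBall _)
    (integrableOn_halfBall _ hG) (integrableOn_halfBall _ hG), hneg]
  ring

theorem integral_halfBall_of_odd {ν u : E} (hu : inner ℝ u ν = 0) {G : E → ℝ}
    (hodd : ∀ x, G ((ℝ ∙ u)ᗮ.reflection x) = -G x) : ∫ x in halfBall ν, G x = 0 := by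
  refine setIntegral_eq_zero_of_reflection u (fun x => ?_) hodd
  simp [halfBall, inner_reflection_orthogonal_of_inner_eq_zero hu]

theorem integral_halfBall_inner_pos {ν : E} (hν : ν ≠ 0) :
    0 < ∫ x in halfBall ν, inner ℝ ν x := by
  rw [setIntegral_pos_iff_support_of_nonneg_ae]
  · have h1 : Metric.ball (0 : E) 1 ∩ {x | 0 < inner ℝ ν x} ⊆
        Function.support (fun x => inner ℝ ν x) ∩ halfBall ν := fun x hx =>
      ⟨(show 0 < inner ℝ ν x from hx.2).ne', Metric.ball_subset_closedBall hx.1, hx.2⟩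
    refine lt_of_lt_of_le ?_ (measure_mono h1)
    refine (Metric.isOpen_ball.inter (isOpen_lt continuous_const (by fun_prop))).measure_pos _ ?_
    have h0 : 0 < ‖ν‖ := norm_pos_iff.2 hν
    refine ⟨(2 * ‖ν‖)⁻¹ • ν, ?_, ?_⟩
    · rw [mem_ball_zero_iff, norm_smul, norm_inv, norm_mul, norm_norm]
      field_simp
      norm_num
    · rw [Set.mem_ofPred_eq, real_inner_smul_right, real_inner_self_eq_norm_sq]
      positivity
  · filter_upwards [ae_restrict_mem (measurableSet_halfBall ν)] with x hx
    exact (show 0 < inner ℝ ν x from hx.2).le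
  · exact integrableOn_halfBall ν (by fun_prop)
end

/-! ### First-order expansion of the covariance of a graph region -/

section
variable {n : ℕ}

theorem reflection_basisFun_apply (i j : Fin n) (y : Euc n) :
    (ℝ ∙ EuclideanSpace.basisFun (Fin n) ℝ i)ᗮ.reflection y j = if j = i then -y j else y j := by
  have h : ∀ z : Euc n, z j = inner ℝ (EuclideanSpace.basisFun (Fin n) ℝ j) z := fun z =>
    (EuclideanSpace.basisFun_inner ..).symm
  split_ifs with hij
  · rw [h, hij, inner_reflection_orthogonal_self, ← hij, ← h]
  · rw [h, inner_reflection_orthogonal_of_inner_eq_zero, ← h]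
    exact (EuclideanSpace.basisFun (Fin n) ℝ).orthonormal.2 (Ne.symm hij)

/-- The quadratic form `y ↦ ½ ∑ κᵢ yᵢ²`, the second-order jet of a hypersurface with principal
curvatures `κᵢ` written as a graph over its tangent space. -/
noncomputable def curvatureForm (κ : Fin n → ℝ) (y : Euc n) : ℝ := (∑ k, κ k * y k ^ 2) / 2

theorem curvatureForm_reflection (κ : Fin n → ℝ) (i : Fin n) (y : Euc n) :
    curvatureForm κ ((ℝ ∙ EuclideanSpace.basisFun (Fin n) ℝ i)ᗮ.reflection y) =
      curvatureForm κ y := by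
  simp only [curvatureForm, reflection_basisFun_apply]
  congr 2
  funext k
  split_ifs <;> simp

theorem integral_coord_mul_curvatureForm (κ : Fin n → ℝ) (i : Fin n) :
    ∫ y in Metric.closedBall (0 : Euc n) 1, y i * curvatureForm κ y = 0 := by
  refine setIntegral_eq_zero_of_reflection (EuclideanSpace.basisFun (Fin n) ℝ i)
    (fun x => by simp) fun y => ?_
  rw [curvatureForm_reflection, reflection_basisFun_apply, if_pos rfl]
  ring

/-- The integral of `yᵢ²` against `curvatureForm κ` over the unit ball: the rate at which the second
moment of the upper half ball in the `i`-th tangent direction decreases when its flat boundary is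
bent according to the curvatures `κ`. -/
noncomputable def curvatureMoment (κ : Fin n → ℝ) (i : Fin n) : ℝ :=
  ballVolume n 1 / ((n + 2) * (n + 4)) * (2 * κ i + ∑ k, κ k) / 2

theorem integral_coord_mul_coord_mul_curvatureForm (κ : Fin n → ℝ) (i j : Fin n) :
    ∫ y in Metric.closedBall (0 : Euc n) 1, y i * y j * curvatureForm κ y =
      if i = j then curvatureMoment κ i else 0 := by
  split_ifs with hij
  · subst hij
    have h1 := fun k => integral_closedBall_inner_sq_mul_inner_sq
      (EuclideanSpace.basisFun (Fin n) ℝ) i k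
    simp only [EuclideanSpace.basisFun_inner, Fintype.card_fin] at h1
    have h2 : ∀ y : Euc n, y i * y i * curvatureForm κ y =
        ∑ k, κ k / 2 * (y i ^ 2 * y k ^ 2) := fun y => by
      rw [curvatureForm, Finset.sum_div, Finset.mul_sum]
      exact Finset.sum_congr rfl fun k _ => by ring
    simp_rw [h2]
    rw [integral_finsetSum _ fun k _ => integrableOn_closedBall (by fun_prop)]
    simp_rw [integral_const_mul, h1]
    rw [curvatureMoment, ballVolume]
    set β := volume.real (Metric.closedBall (0 : Euc n) 1) / (((n : ℝ) + 2) * (n + 4))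
    have h3 : ∀ k, κ k / 2 * (β * if i = k then 3 else 1) =
        β / 2 * κ k + if i = k then β * κ k else 0 := fun k => by
      split_ifs <;> ring
    simp_rw [h3, Finset.sum_add_distrib, ← Finset.mul_sum, Finset.sum_ite_eq]
    simp only [Finset.mem_univ, if_true]
    ring
  · refine setIntegral_eq_zero_of_reflection (EuclideanSpace.basisFun (Fin n) ℝ i)
      (fun x => by simp) fun y => ?_
    rw [curvatureForm_reflection, reflection_basisFun_apply, reflection_basisFun_apply, if_pos rfl,
      if_neg (Ne.symm hij)]
    ring
end

section
variable {E : Type*} [NormedAddCommGroup E] [InnerProductSpace ℝ E]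
  {n : ℕ} {b : OrthonormalBasis (Fin (n + 1)) ℝ E}

theorem inner_castSucc_reflection (i : Fin n) (k : Fin (n + 1)) (x : E) :
    inner ℝ (b k) ((ℝ ∙ b i.castSucc)ᗮ.reflection x) =
      if k = i.castSucc then -inner ℝ (b k) x else inner ℝ (b k) x := by
  split_ifs with h
  · rw [h, inner_reflection_orthogonal_self]
  · rw [inner_reflection_orthogonal_of_inner_eq_zero (b.orthonormal.2 (Ne.symm h))]

theorem inner_castSucc_last (i : Fin n) : inner ℝ (b i.castSucc) (b (Fin.last n)) = 0 :=
  b.orthonormal.2 (Fin.castSucc_lt_last i).ne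

variable [MeasurableSpace E] [BorelSpace E] {κ : Fin n → ℝ} {D : ℝ → Set E}

/-- The first-order coefficients of the second moments; those involving the normal coordinate
vanish because this coordinate is zero on the equator. -/
theorem integral_equator_inner_castSucc_mul (i : Fin n) (k : Fin (n + 1)) :
    ∫ y in Metric.closedBall (0 : Euc n) 1, inner ℝ (b i.castSucc) (graphCoord b (y, 0)) *
      inner ℝ (b k) (graphCoord b (y, 0)) * curvatureForm κ y =
      if k = i.castSucc then curvatureMoment κ i else 0 := by
  induction k using Fin.lastCases with
  | last => simp [inner_last_graphCoord, (Fin.castSucc_lt_last i).ne']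
  | cast j =>
    simp_rw [inner_castSucc_graphCoord, integral_coord_mul_coord_mul_curvatureForm,
      Fin.castSucc_inj, eq_comm (a := i)]

variable [FiniteDimensional ℝ E]

variable (b) in
/-- The entries in the basis `b` of the (not normalized) covariance matrix of `A`, by the formula
`∫ xᵢ xⱼ - V⁻¹ (∫ xᵢ) (∫ xⱼ)`. -/
noncomputable def covarianceEntry (A : Set E) (i j : Fin (n + 1)) : ℝ :=
  (∫ x in A, inner ℝ (b i) x * inner ℝ (b j) x) -
    (volume.real A)⁻¹ * ((∫ x in A, inner ℝ (b i) x) * ∫ x in A, inner ℝ (b j) x)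

theorem volume_real_halfBall {ν : E} (hν : ν ≠ 0) :
    volume.real (halfBall ν) = volume.real (Metric.closedBall (0 : E) 1) / 2 := by
  have := integral_halfBall_of_even hν (G := fun _ => 1) continuous_const (fun _ => rfl)
  simpa using this

theorem volume_real_closedBall_pos : 0 < volume.real (Metric.closedBall (0 : E) 1) :=
  ENNReal.toReal_pos (Metric.measure_closedBall_pos _ _ one_pos).ne' measure_closedBall_lt_top.ne

theorem IsGraphRegion.tendsto_volume (h : IsGraphRegion b (curvatureForm κ) D) :
    Tendsto (fun ε => volume.real (D ε)) (𝓝[>] 0)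
      (𝓝 (volume.real (Metric.closedBall (0 : E) 1) / 2)) := by
  rw [← volume_real_halfBall (b.orthonormal.ne_zero (Fin.last n))]
  simpa using h.tendsto_integral (G := fun _ => 1) continuous_const

theorem integral_halfBall_inner_castSucc (i : Fin n) :
    ∫ x in halfBall (b (Fin.last n)), inner ℝ (b i.castSucc) x = 0 :=
  integral_halfBall_of_odd (inner_castSucc_last i)
    fun x => by rw [inner_castSucc_reflection, if_pos rfl]

variable (E n) in
/-- The second moment of the upper half of the unit ball of the `(n + 1)`-dimensional space `E`, in
any direction. -/
noncomputable def halfBallMoment : ℝ :=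
  volume.real (Metric.closedBall (0 : E) 1) / (2 * (n + 3))

theorem integral_halfBall_inner_sq (k : Fin (n + 1)) :
    ∫ x in halfBall (b (Fin.last n)), inner ℝ (b k) x * inner ℝ (b k) x = halfBallMoment E n := by
  rw [integral_halfBall_of_even (b.orthonormal.ne_zero _) (by fun_prop)]
  · have := integral_closedBall_inner_sq b k
    rw [Fintype.card_fin] at this
    simp_rw [← pow_two, this, halfBallMoment]
    push_cast
    rw [div_div]
    ring
  · intro x
    rcases eq_or_ne k (Fin.last n) with rfl | hk
    · rw [inner_reflection_orthogonal_self]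
      ring
    · rw [inner_reflection_orthogonal_of_inner_eq_zero (b.orthonormal.2 hk.symm)]

theorem integral_halfBall_inner_castSucc_mul (i : Fin n) (k : Fin (n + 1)) :
    ∫ x in halfBall (b (Fin.last n)), inner ℝ (b i.castSucc) x * inner ℝ (b k) x =
      if k = i.castSucc then halfBallMoment E n else 0 := by
  split_ifs with hk
  · rw [hk, integral_halfBall_inner_sq]
  · refine integral_halfBall_of_odd (inner_castSucc_last i) fun x => ?_
    rw [inner_castSucc_reflection, inner_castSucc_reflection, if_pos rfl, if_neg hk]
    ring

/-- First-order expansion of the rows of the covariance matrix of a graph region which correspond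
to tangent directions. The first moments in tangent directions are `o(ε)`, so that the barycenter
does not contribute. -/
theorem IsGraphRegion.tendsto_covarianceEntry_castSucc (h : IsGraphRegion b (curvatureForm κ) D)
    (i : Fin n) (k : Fin (n + 1)) :
    Tendsto (fun ε : ℝ => ε⁻¹ * (covarianceEntry b (D ε) i.castSucc k -
      if k = i.castSucc then halfBallMoment E n - ε * curvatureMoment κ i else 0))
      (𝓝[>] 0) (𝓝 0) := by
  have h1 := h.tendsto_integral_sub
    (G := fun x => inner ℝ (b i.castSucc) x * inner ℝ (b k) x) (by fun_prop)
  rw [integral_equator_inner_castSucc_mul, integral_halfBall_inner_castSucc_mul] at h1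
  have h2 := h.tendsto_integral_sub (G := fun x => inner ℝ (b i.castSucc) x) (by fun_prop)
  simp_rw [inner_castSucc_graphCoord, integral_coord_mul_curvatureForm,
    integral_halfBall_inner_castSucc, sub_zero, neg_zero] at h2
  have h3 := h.tendsto_integral (G := fun x => inner ℝ (b k) x) (by fun_prop)
  have h4 := h.tendsto_volume.inv₀ (div_pos volume_real_closedBall_pos two_pos).ne'
  have h5 := (h1.sub (h4.mul (h2.mul h3))).add_const
    (if k = i.castSucc then curvatureMoment κ i else 0)
  rw [zero_mul, mul_zero, sub_zero, neg_add_cancel] at h5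
  refine h5.congr' ?_
  filter_upwards [self_mem_nhdsWithin] with ε (hε : 0 < ε)
  rw [covarianceEntry]
  split_ifs
  · field_simp
    ring
  · field_simp
    ring

/-- In the normal direction the half ball has the same second moment as in the tangent directions,
but its barycenter lies at positive height, which lowers the variance. -/
theorem IsGraphRegion.tendsto_covarianceEntry_last (h : IsGraphRegion b (curvatureForm κ) D) :
    ∃ c < halfBallMoment E n, Tendsto (fun ε : ℝ =>
      covarianceEntry b (D ε) (Fin.last n) (Fin.last n)) (𝓝[>] 0) (𝓝 c) := by
  have h1 := h.tendsto_integral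
    (G := fun x => inner ℝ (b (Fin.last n)) x * inner ℝ (b (Fin.last n)) x) (by fun_prop)
  rw [integral_halfBall_inner_sq] at h1
  have h2 := h.tendsto_integral (G := fun x => inner ℝ (b (Fin.last n)) x) (by fun_prop)
  have h3 := div_pos (volume_real_closedBall_pos (E := E)) two_pos
  have h4 := h.tendsto_volume.inv₀ h3.ne'
  refine ⟨_, ?_, h1.sub (h4.mul (h2.mul h2))⟩
  have h5 := integral_halfBall_inner_pos (b.orthonormal.ne_zero (Fin.last n))
  exact sub_lt_self _ (by positivity)
end

/-! ### Rescaling the covariance matrix -/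

section
variable {m : ℕ}

theorem integrableOn_of_subset_closedBall {W : Set (Euc m)} {p : Euc m} {r : ℝ}
    (hW : W ⊆ Metric.closedBall p r) {F : Type*} [NormedAddCommGroup F] {G : Euc m → F}
    (hG : Continuous G) : IntegrableOn G W :=
  (hG.continuousOn.integrableOn_compact (isCompact_closedBall _ _)).mono_set hW

/-- The quadratic form of the covariance matrix, which gives its entries in any basis. -/
theorem inner_toEuclideanLin_covarianceMatrix {D : Set (Euc m)} {p : Euc m} {r : ℝ}
    (hD : D ⊆ Metric.closedBall p r) (u v : Euc m) :
    inner ℝ (Matrix.toEuclideanLin (covarianceMatrix D) u) v =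
      ∫ x in D, inner ℝ u (x - barycenter D) * inner ℝ v (x - barycenter D) := by
  have h1 : ∀ x : Euc m, inner ℝ u (x - barycenter D) * inner ℝ v (x - barycenter D) =
      ∑ i, ∑ j, v i * u j * ((x i - barycenter D i) * (x j - barycenter D j)) := fun x => by
    simp only [PiLp.inner_apply, RCLike.inner_apply, conj_trivial, PiLp.sub_apply]
    rw [Finset.sum_mul_sum, Finset.sum_comm]
    exact Finset.sum_congr rfl fun i _ => Finset.sum_congr rfl fun j _ => by ring
  simp_rw [h1]
  rw [integral_finsetSum _ fun i _ => integrableOn_of_subset_closedBall hD (by fun_prop)]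
  have h2 : ∀ i, ∫ x in D, ∑ j, v i * u j * ((x i - barycenter D i) * (x j - barycenter D j)) =
      ∑ j, v i * u j * covarianceMatrix D i j := fun i => by
    rw [integral_finsetSum _ fun j _ => integrableOn_of_subset_closedBall hD (by fun_prop)]
    exact Finset.sum_congr rfl fun j _ => integral_const_mul _ _
  simp_rw [h2]
  simp only [PiLp.inner_apply, RCLike.inner_apply, conj_trivial, Matrix.toLpLin_apply,
    Matrix.mulVec, dotProduct]
  refine Finset.sum_congr rfl fun i _ => ?_
  rw [Finset.mul_sum]
  exact Finset.sum_congr rfl fun j _ => by ring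

open scoped Pointwise in
theorem setIntegral_eq_smul_setIntegral_rescaled {F : Type*} [NormedAddCommGroup F]
    [NormedSpace ℝ F] {ε : ℝ} (hε : 0 < ε) (p : Euc m) (D : Set (Euc m)) (G : Euc m → F) :
    ∫ x in D, G x = ε ^ m • ∫ w in {w | p + ε • w ∈ D}, G (p + ε • w) := by
  have h1 := (measurePreserving_add_left (volume : Measure (Euc m)) p).setIntegral_preimage_emb
    (measurableEmbedding_addLeft p) G D
  have h2 := Measure.setIntegral_comp_smul_of_pos (volume : Measure (Euc m))
    (fun w => G (p + w)) {w | p + ε • w ∈ D} hε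
  have h3 : ε • {w | p + ε • w ∈ D} = (fun x => p + x) ⁻¹' D := by
    ext x
    rw [Set.mem_smul_set_iff_inv_smul_mem₀ hε.ne']
    simp [smul_inv_smul₀ hε.ne']
  rw [h3, h1, finrank_euclideanSpace_fin] at h2
  rw [h2, smul_inv_smul₀ (by positivity)]

/-- Scaling of the covariance: the second moments of `D` are `ε ^ (n + 3)` times those of its
rescaled copy, and the barycenter is eliminated. -/
theorem inner_toEuclideanLin_covarianceMatrix_eq_covarianceEntry {n : ℕ}
    (b : OrthonormalBasis (Fin (n + 1)) ℝ (Euc (n + 1))) {ε : ℝ} (hε : 0 < ε) {p : Euc (n + 1)}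
    {D : Set (Euc (n + 1))} (hD : {w | p + ε • w ∈ D} ⊆ Metric.closedBall 0 1)
    (hV : volume.real {w | p + ε • w ∈ D} ≠ 0) (i j : Fin (n + 1)) :
    inner ℝ (Matrix.toEuclideanLin (covarianceMatrix D) (b i)) (b j) =
      ε ^ (n + 3) * covarianceEntry b {w | p + ε • w ∈ D} i j := by
  have hD' : D ⊆ Metric.closedBall p ε := fun x hx => by
    have h1 : ε⁻¹ • (x - p) ∈ {w | p + ε • w ∈ D} := by simpa [smul_inv_smul₀ hε.ne'] using hx
    have h2 := hD h1
    rw [mem_closedBall_zero_iff, norm_smul, norm_inv, Real.norm_eq_abs, abs_of_pos hε,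
      inv_mul_le_iff₀ hε, mul_one] at h2
    rwa [mem_closedBall_iff_norm]
  set W := {w | p + ε • w ∈ D} with hW
  have hWi : ∀ {F : Type} [NormedAddCommGroup F] {G : Euc (n + 1) → F}, Continuous G →
      IntegrableOn G W := fun hG => integrableOn_of_subset_closedBall hD hG
  have hWf : IsFiniteMeasure (volume.restrict W) := by
    refine ⟨?_⟩
    rw [Measure.restrict_apply_univ]
    exact (measure_mono hD).trans_lt measure_closedBall_lt_top
  have hVD : volume.real D = ε ^ (n + 1) * volume.real W := by
    have := setIntegral_eq_smul_setIntegral_rescaled hε p D (fun _ => (1 : ℝ))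
    simpa using this
  set s := (volume.real W)⁻¹ • ∫ w in W, w with hs
  have hbar : barycenter D = p + ε • s := by
    rw [barycenter, hVD, setIntegral_eq_smul_setIntegral_rescaled hε p D, ← hW,
      integral_add (integrable_const p) (hWi (by fun_prop)), integral_smul, integral_const,
      measureReal_restrict_apply_univ, smul_smul, smul_add, smul_smul, hs, smul_comm ε, mul_inv]
    congr 1
    · rw [show (ε ^ (n + 1))⁻¹ * (volume.real W)⁻¹ * ε ^ (n + 1) * volume.real W = 1 by
        field_simp, one_smul]
    · rw [show (ε ^ (n + 1))⁻¹ * (volume.real W)⁻¹ * ε ^ (n + 1) = (volume.real W)⁻¹ by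
        field_simp]
  have hsi : ∀ k, inner ℝ (b k) s = (volume.real W)⁻¹ * ∫ w in W, inner ℝ (b k) w := fun k => by
    rw [hs, real_inner_smul_right, integral_inner (f := fun w => w) (hWi continuous_id)]
  rw [inner_toEuclideanLin_covarianceMatrix hD', setIntegral_eq_smul_setIntegral_rescaled hε p D,
    ← hW, hbar]
  have h1 : ∀ w, inner ℝ (b i) (p + ε • w - (p + ε • s)) * inner ℝ (b j) (p + ε • w - (p + ε • s)) =
      ε ^ 2 * (inner ℝ (b i) w * inner ℝ (b j) w - inner ℝ (b i) s * inner ℝ (b j) w -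
        inner ℝ (b j) s * inner ℝ (b i) w + inner ℝ (b i) s * inner ℝ (b j) s) := fun w => by
    rw [add_sub_add_left_eq_sub, ← smul_sub, real_inner_smul_right, real_inner_smul_right,
      inner_sub_right, inner_sub_right]
    ring
  simp_rw [h1]
  rw [integral_const_mul, integral_add _ (integrable_const _), integral_sub, integral_sub,
    integral_const_mul, integral_const_mul, integral_const, measureReal_restrict_apply_univ,
    hsi, hsi, covarianceEntry]
  · simp only [smul_eq_mul]
    field_simp
    ring
  all_goals exact hWi (by fun_prop)
end

theorem abs_sum_mul_inner_mul_inner_le {ι E : Type*} [Fintype ι] [NormedAddCommGroup E]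
    [InnerProductSpace ℝ E] (b : OrthonormalBasis ι ℝ E) (B : ι → ι → ℝ) (x : E) :
    |∑ i, ∑ j, B i j * (inner ℝ (b i) x * inner ℝ (b j) x)| ≤ (∑ i, ∑ j, |B i j|) * ‖x‖ ^ 2 := by
  have h : ∀ i, |inner ℝ (b i) x| ≤ ‖x‖ := fun i => by
    simpa using abs_real_inner_le_norm (b i) x
  rw [Finset.sum_mul]
  refine (Finset.abs_sum_le_sum_abs _ _).trans (Finset.sum_le_sum fun i _ => ?_)
  rw [Finset.sum_mul]
  refine (Finset.abs_sum_le_sum_abs _ _).trans (Finset.sum_le_sum fun j _ => ?_)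
  rw [abs_mul, abs_mul, pow_two]
  gcongr <;> exact h _

theorem inner_map_self_eq_sum_sum {ι E : Type*} [Fintype ι] [NormedAddCommGroup E]
    [InnerProductSpace ℝ E] (b : OrthonormalBasis ι ℝ E) (T : E →ₗ[ℝ] E) (x : E) :
    inner ℝ (T x) x =
      ∑ i, ∑ j, inner ℝ (T (b i)) (b j) * (inner ℝ (b i) x * inner ℝ (b j) x) := by
  conv_lhs => rw [← b.sum_repr' x, map_sum, sum_inner]
  refine Finset.sum_congr rfl fun i _ => ?_
  rw [inner_sum]
  refine Finset.sum_congr rfl fun j _ => ?_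
  rw [map_smul, real_inner_smul_left, real_inner_smul_right]
  ring

/-- The comparison of eigenvalues in terms of the matrix of `T` in the basis `b`. -/
theorem abs_eigenvalue_sub_le_of_entries {ι E : Type*} [Fintype ι] [DecidableEq ι]
    [NormedAddCommGroup E] [InnerProductSpace ℝ E] (b b' : OrthonormalBasis ι ℝ E)
    (T : E →ₗ[ℝ] E) (lam d : ι → ℝ) (hT : ∀ i, T (b' i) = lam i • b' i) (i : ι)
    (hup : ∀ j, d i < d j → lam i ≤ lam j) (hdown : ∀ j, d j < d i → lam j ≤ lam i) :
    |lam i - d i| ≤ ∑ k, ∑ l, |inner ℝ (T (b k)) (b l) - if l = k then d k else 0| := by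
  refine abs_eigenvalue_sub_le b b' T lam d hT _ (fun x => ?_) i hup hdown
  refine le_trans (le_of_eq ?_) (abs_sum_mul_inner_mul_inner_le b _ x)
  congr 1
  rw [inner_map_self_eq_sum_sum b, ← Finset.sum_sub_distrib]
  refine Finset.sum_congr rfl fun k _ => ?_
  simp_rw [sub_mul, Finset.sum_sub_distrib]
  congr 1
  simp only [ite_mul, zero_mul, Finset.sum_ite_eq', Finset.mem_univ, if_true]
  ring

/-! ### Asymptotics of the eigenvalues -/

theorem ballVolume_eq (m : ℕ) {ε : ℝ} (hε : 0 ≤ ε) : ballVolume m ε = ε ^ m * ballVolume m 1 := by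
  rw [ballVolume, ballVolume, measureReal_def, Measure.addHaar_closedBall' _ _ hε]
  simp [measureReal_def, hε]

theorem ballVolume_one_pos (m : ℕ) : 0 < ballVolume m 1 := volume_real_closedBall_pos

theorem covarianceEntry_comm {E : Type*} [NormedAddCommGroup E] [InnerProductSpace ℝ E]
    [MeasurableSpace E] [BorelSpace E] [FiniteDimensional ℝ E] {n : ℕ}
    (b : OrthonormalBasis (Fin (n + 1)) ℝ E) (A : Set E)
    (i j : Fin (n + 1)) : covarianceEntry b A i j = covarianceEntry b A j i := by
  simp only [covarianceEntry, mul_comm]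

section
variable {n : ℕ} {κ : Fin n → ℝ}

/-- The first-order shifts are ordered as the curvatures, which makes the labelling by curvatures
compatible with the model eigenvalues. -/
theorem curvatureMoment_lt_iff {i j : Fin n} :
    curvatureMoment κ i < curvatureMoment κ j ↔ κ i < κ j := by
  have h : 0 < ballVolume n 1 / (((n : ℝ) + 2) * (n + 4)) :=
    div_pos (ballVolume_one_pos n) (by positivity)
  rw [curvatureMoment, curvatureMoment, div_lt_div_iff_of_pos_right two_pos,
    mul_lt_mul_iff_right₀ h]
  constructor <;> intro h <;> linarith

/-- The eigenvalues predicted at first order in `ε` for the rescaled covariance matrix, the last one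
being its actual normal entry. -/
noncomputable def modelEigenvalue (b : OrthonormalBasis (Fin (n + 1)) ℝ (Euc (n + 1)))
    (κ : Fin n → ℝ) (W : Set (Euc (n + 1))) (ε : ℝ) : Fin (n + 1) → ℝ :=
  Fin.lastCases (covarianceEntry b W (Fin.last n) (Fin.last n))
    fun i => halfBallMoment (Euc (n + 1)) n - ε * curvatureMoment κ i

variable {b : OrthonormalBasis (Fin (n + 1)) ℝ (Euc (n + 1))} {W : ℝ → Set (Euc (n + 1))}

/-- The covariance matrix of a graph region is diagonal in the basis `b`, with the model
eigenvalues on the diagonal, up to an error `o(ε)`. -/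
theorem IsGraphRegion.tendsto_entry_error (h : IsGraphRegion b (curvatureForm κ) W) :
    Tendsto (fun ε : ℝ => ε⁻¹ * ∑ k, ∑ l, |covarianceEntry b (W ε) k l -
      if l = k then modelEigenvalue b κ (W ε) ε k else 0|) (𝓝[>] 0) (𝓝 0) := by
  have h1 : ∀ k l, Tendsto (fun ε : ℝ => ε⁻¹ * (covarianceEntry b (W ε) k l -
      if l = k then modelEigenvalue b κ (W ε) ε k else 0)) (𝓝[>] 0) (𝓝 0) := by
    intro k l
    induction k using Fin.lastCases with
    | last =>
      induction l using Fin.lastCases with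
      | last => simp [modelEigenvalue]
      | cast j =>
        have := h.tendsto_covarianceEntry_castSucc j (Fin.last n)
        simp only [(Fin.castSucc_lt_last j).ne', (Fin.castSucc_lt_last j).ne, if_false] at this ⊢
        simpa only [covarianceEntry_comm b _ j.castSucc] using this
    | cast i => simpa [modelEigenvalue] using h.tendsto_covarianceEntry_castSucc i l
  have h2 : Tendsto (fun ε : ℝ => ∑ k, ∑ l, |ε⁻¹ * (covarianceEntry b (W ε) k l -
      if l = k then modelEigenvalue b κ (W ε) ε k else 0)|) (𝓝[>] 0)
      (𝓝 (∑ _k : Fin (n + 1), ∑ _l : Fin (n + 1), |(0 : ℝ)|)) :=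
    tendsto_finsetSum _ fun k _ => tendsto_finsetSum _ fun l _ => (h1 k l).abs
  simp only [abs_zero, Finset.sum_const_zero] at h2
  refine h2.congr' ?_
  filter_upwards [self_mem_nhdsWithin] with ε (hε : 0 < ε)
  simp_rw [abs_mul, abs_of_pos (inv_pos.2 hε), ← Finset.mul_sum]

/-- The spectral gap between the normal and the tangent directions. -/
theorem IsGraphRegion.eventually_normal_lt (h : IsGraphRegion b (curvatureForm κ) W) :
    ∀ᶠ ε in 𝓝[>] (0 : ℝ), ∀ i : Fin n, modelEigenvalue b κ (W ε) ε (Fin.last n) <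
      modelEigenvalue b κ (W ε) ε i.castSucc := by
  obtain ⟨c, hc, hlim⟩ := h.tendsto_covarianceEntry_last
  refine eventually_all.2 fun i => ?_
  have h2 : Tendsto (fun ε : ℝ => halfBallMoment (Euc (n + 1)) n - ε * curvatureMoment κ i)
      (𝓝[>] 0) (𝓝 (halfBallMoment (Euc (n + 1)) n - 0 * curvatureMoment κ i)) :=
    (Continuous.tendsto (by fun_prop) 0).mono_left nhdsWithin_le_nhds
  rw [zero_mul, sub_zero] at h2
  simpa [modelEigenvalue] using hlim.eventually_lt h2 hc

/-- The rescaled tangent eigenvalues agree with the model up to `o(ε)`. -/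
theorem tendsto_eigenvalue_sub_model {p : Euc (n + 1)} {D : ℝ → Set (Euc (n + 1))}
    (h : IsGraphRegion b (curvatureForm κ) (fun ε => {w | p + ε • w ∈ D ε}))
    {lam : ℝ → Fin (n + 1) → ℝ}
    (hlam : ∀ᶠ ε in 𝓝[>] (0 : ℝ), IsEigenvalueList (covarianceMatrix (D ε)) (lam ε) ∧
      IsCurvatureLabelling κ (lam ε)) (i : Fin n) :
    Tendsto (fun ε : ℝ => ε⁻¹ * ((ε ^ (n + 3))⁻¹ * lam ε i.castSucc -
      (halfBallMoment (Euc (n + 1)) n - ε * curvatureMoment κ i))) (𝓝[>] 0) (𝓝 0) := by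
  refine squeeze_zero_norm' ?_ h.tendsto_entry_error
  have hV := h.tendsto_volume.eventually_ne (div_pos volume_real_closedBall_pos two_pos).ne'
  filter_upwards [self_mem_nhdsWithin, hlam, h.eventually_normal_lt, hV, h.subset] with
    ε (hε : 0 < ε) ⟨⟨b', hb'⟩, hlab⟩ hlast hV hsub
  have hε' : 0 < (ε ^ (n + 3))⁻¹ := by positivity
  have key := abs_eigenvalue_sub_le_of_entries b b'
    ((ε ^ (n + 3))⁻¹ • Matrix.toEuclideanLin (covarianceMatrix (D ε)))
    (fun k => (ε ^ (n + 3))⁻¹ * lam ε k) (modelEigenvalue b κ {w | p + ε • w ∈ D ε} ε)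
    (fun k => by rw [LinearMap.smul_apply, hb', smul_smul]) i.castSucc
    (fun j hj => by
      induction j using Fin.lastCases with
      | last => exact absurd hj (hlast i).not_gt
      | cast j =>
        simp only [modelEigenvalue, Fin.lastCases_castSucc, sub_lt_sub_iff_left,
          mul_lt_mul_iff_right₀ hε, curvatureMoment_lt_iff] at hj
        exact mul_le_mul_of_nonneg_left (hlab.2 _ _ hj) hε'.le)
    (fun j hj => by
      induction j using Fin.lastCases with
      | last => exact mul_le_mul_of_nonneg_left (hlab.1 i) hε'.le
      | cast j =>
        simp only [modelEigenvalue, Fin.lastCases_castSucc, sub_lt_sub_iff_left,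
          mul_lt_mul_iff_right₀ hε, curvatureMoment_lt_iff] at hj
        exact mul_le_mul_of_nonneg_left (hlab.2 _ _ hj) hε'.le)
  simp_rw [LinearMap.smul_apply, real_inner_smul_left,
    inner_toEuclideanLin_covarianceMatrix_eq_covarianceEntry b hε hsub hV,
    inv_mul_cancel_left₀ (pow_pos hε (n + 3)).ne'] at key
  rw [norm_mul, norm_inv, Real.norm_eq_abs, Real.norm_eq_abs, abs_of_pos hε]
  refine mul_le_mul_of_nonneg_left ?_ (inv_nonneg.2 hε.le)
  simpa [modelEigenvalue] using key

theorem tendsto_eigenvalue_ratio {p : Euc (n + 1)} {D : ℝ → Set (Euc (n + 1))}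
    (h : IsGraphRegion b (curvatureForm κ) (fun ε => {w | p + ε • w ∈ D ε}))
    {lam : ℝ → Fin (n + 1) → ℝ}
    (hlam : ∀ᶠ ε in 𝓝[>] (0 : ℝ), IsEigenvalueList (covarianceMatrix (D ε)) (lam ε) ∧
      IsCurvatureLabelling κ (lam ε)) (μ ν : Fin n) :
    Tendsto
      (fun ε : ℝ => ballVolume (n + 1) ε ^ 2 / ballVolume n ε *
        ((lam ε μ.castSucc - lam ε ν.castSucc) / (lam ε μ.castSucc * lam ε ν.castSucc)))
      (𝓝[>] (0 : ℝ))
      (𝓝 (4 * ((n : ℝ) + 3) ^ 2 / (((n : ℝ) + 2) * ((n : ℝ) + 4)) * (κ ν - κ μ))) := by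
  have hε0 : Tendsto (fun ε : ℝ => ε) (𝓝[>] 0) (𝓝 0) := nhdsWithin_le_nhds
  set a := halfBallMoment (Euc (n + 1)) n with ha
  have ha0 : 0 < a := div_pos volume_real_closedBall_pos (by positivity)
  have hdev := tendsto_eigenvalue_sub_model h hlam
  have hval : ∀ i : Fin n, Tendsto (fun ε : ℝ => (ε ^ (n + 3))⁻¹ * lam ε i.castSucc)
      (𝓝[>] 0) (𝓝 a) := fun i => by
    have := (hε0.mul (hdev i)).add
      ((tendsto_const_nhds (x := a)).sub (hε0.mul_const (curvatureMoment κ i)))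
    rw [zero_mul, zero_mul, sub_zero, zero_add] at this
    refine this.congr' ?_
    filter_upwards [self_mem_nhdsWithin] with ε (hε : 0 < ε)
    rw [mul_inv_cancel_left₀ hε.ne']
    ring
  have hdiff : Tendsto (fun ε : ℝ => ε⁻¹ * ((ε ^ (n + 3))⁻¹ * lam ε μ.castSucc -
      (ε ^ (n + 3))⁻¹ * lam ε ν.castSucc)) (𝓝[>] 0)
      (𝓝 (curvatureMoment κ ν - curvatureMoment κ μ)) := by
    have := ((hdev μ).sub (hdev ν)).add_const (curvatureMoment κ ν - curvatureMoment κ μ)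
    rw [sub_zero, zero_add] at this
    refine this.congr' ?_
    filter_upwards [self_mem_nhdsWithin] with ε (hε : 0 < ε)
    field_simp
    ring
  have hlim := (hdiff.div ((hval μ).mul (hval ν)) (mul_pos ha0 ha0).ne').const_mul
    (ballVolume (n + 1) 1 ^ 2 / ballVolume n 1)
  have hconst : ballVolume (n + 1) 1 ^ 2 / ballVolume n 1 *
      ((curvatureMoment κ ν - curvatureMoment κ μ) / (a * a)) =
      4 * ((n : ℝ) + 3) ^ 2 / (((n : ℝ) + 2) * ((n : ℝ) + 4)) * (κ ν - κ μ) := by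
    have h1 := ballVolume_one_pos n
    have h2 := ballVolume_one_pos (n + 1)
    have h3 : a = ballVolume (n + 1) 1 / (2 * (n + 3)) := rfl
    rw [h3, curvatureMoment, curvatureMoment]
    field_simp
    ring
  rw [hconst] at hlim
  refine hlim.congr' ?_
  filter_upwards [self_mem_nhdsWithin] with ε (hε : 0 < ε)
  rw [ballVolume_eq _ hε.le, ballVolume_eq n hε.le]
  have h1 := (ballVolume_one_pos n).ne'
  -- if one of the eigenvalues vanishes, both quotients are zero by convention
  rcases eq_or_ne (lam ε μ.castSucc) 0 with hμ | hμ
  · simp [hμ]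
  rcases eq_or_ne (lam ε ν.castSucc) 0 with hν | hν
  · simp [hν]
  simp only [Pi.div_apply]
  rw [← mul_sub]
  field_simp
  ring
end

/-! ### Defining functions of a hypersurface -/

section
variable {E : Type*} [NormedAddCommGroup E] [NormedSpace ℝ E]

/-- Regular level sets contain a smooth curve with any velocity in the kernel of the
differential. -/
theorem exists_curve_of_fderiv_eq_zero {f : E → ℝ} {q v : E} (hf : ContDiffAt ℝ ∞ f q)
    (hq : f q = 0) (hreg : fderiv ℝ f q ≠ 0) (hv : fderiv ℝ f q v = 0) :
    ∃ γ : ℝ → E, γ 0 = q ∧ ContDiffAt ℝ ∞ γ 0 ∧ (∀ᶠ t in 𝓝 (0 : ℝ), f (γ t) = 0) ∧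
      HasDerivAt γ v 0 := by
  obtain ⟨u, hu⟩ : ∃ u, fderiv ℝ f q u ≠ 0 := by
    by_contra! h
    exact hreg (ContinuousLinearMap.ext h)
  let A : ℝ × ℝ →L[ℝ] E := (ContinuousLinearMap.fst ℝ ℝ ℝ).smulRight v +
    (ContinuousLinearMap.snd ℝ ℝ ℝ).smulRight u
  let F : ℝ × ℝ → ℝ := fun w => f (q + A w)
  have hA0 : q + A (0, 0) = q := by simp [A]
  have hF : ContDiffAt ℝ ∞ F (0, 0) := by
    refine ContDiffAt.comp (0, 0) (by rwa [hA0]) ?_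
    fun_prop
  have hF' : HasFDerivAt F ((fderiv ℝ f q).comp A) (0, 0) := by
    have h1 : HasFDerivAt f (fderiv ℝ f q) (q + A (0, 0)) := by
      rw [hA0]
      exact (hf.differentiableAt (by simp)).hasFDerivAt
    exact h1.comp (0, 0) (A.hasFDerivAt.const_add q)
  have hinv : (fderiv ℝ F (0, 0) ∘L .inr ℝ ℝ ℝ).IsInvertible := by
    refine ⟨ContinuousLinearEquiv.unitsEquivAut ℝ (Units.mk0 _ hu), ?_⟩
    ext
    simp [hF'.fderiv, A]
  have hne : (∞ : WithTop ℕ∞) ≠ 0 := by simp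
  set ψ := hF.implicitFunction hne hinv with hψ
  have hψ0 : ψ 0 = 0 := hF.implicitFunction_apply_self hne hinv
  have hψs : ContDiffAt ℝ ∞ ψ 0 := hF.contDiffAt_implicitFunction hne hinv
  have hψF : ∀ᶠ t in 𝓝 (0 : ℝ), F (t, ψ t) = F (0, 0) :=
    hF.eventually_apply_implicitFunction hne hinv
  have hψd : HasDerivAt ψ 0 0 := by
    have := (hF.hasStrictFDerivAt_implicitFunction hne hinv).hasFDerivAt.hasDerivAt
    refine this.congr_deriv ?_
    have h0 : fderiv ℝ F (0, 0) ∘L .inl ℝ ℝ ℝ = 0 := by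
      ext
      simp [hF'.fderiv, A, hv]
    simp [h0]
  refine ⟨fun t => q + A (t, ψ t), by simp [hψ0, A], ?_, ?_, ?_⟩
  · exact contDiffAt_const.add (A.contDiff.contDiffAt.comp 0 (contDiffAt_id.prodMk hψs))
  · filter_upwards [hψF] with t ht
    have h0 : F (0, 0) = 0 := by simp only [F, hA0, hq]
    rw [← h0, ← ht]
  · have := (A.hasFDerivAt.comp_hasDerivAt 0 ((hasDerivAt_id 0).prodMk hψd)).const_add q
    exact this.congr_deriv (by simp [A])

/-- Second-order Taylor expansion with Peano remainder. -/
theorem taylor_two_isLittleO {f : E → ℝ} {p : E} (hf : ContDiffAt ℝ 2 f p) :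
    (fun x => f (p + x) - f p - fderiv ℝ f p x - (1 / 2) * fderiv ℝ (fderiv ℝ f) p x x)
      =o[𝓝 0] fun x => ‖x‖ ^ 2 := by
  set B := fderiv ℝ (fderiv ℝ f) p with hB
  have hsymm : ∀ v w, B v w = B w v := fun v w => (hf.isSymmSndFDerivAt (by simp)).eq v w
  have hd : HasFDerivAt (fderiv ℝ f) B p :=
    ((hf.fderiv_right (m := 1) (by norm_num)).differentiableAt (by simp)).hasFDerivAt
  have hev : ∀ᶠ x in 𝓝 p, DifferentiableAt ℝ f x :=
    (hf.eventually (by simp)).mono fun x hx => hx.differentiableAt (by simp)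
  rw [Asymptotics.isLittleO_iff]
  intro c hc
  have h1 := (hasFDerivAt_iff_isLittleO_nhds_zero.1 hd).def hc
  have h2 : ∀ᶠ x in 𝓝 (0 : E), DifferentiableAt ℝ f (p + x) := by
    have : Tendsto (fun x => p + x) (𝓝 (0 : E)) (𝓝 p) := by
      simpa using (continuous_const_add p).tendsto (0 : E)
    exact this.eventually hev
  obtain ⟨r, hr, hball⟩ := Metric.eventually_nhds_iff_ball.1 (h1.and h2)
  filter_upwards [Metric.ball_mem_nhds (0 : E) hr] with x hx
  have hx' : ‖x‖ < r := by simpa using hx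
  let R : E → ℝ := fun x => f (p + x) - f p - fderiv ℝ f p x - (1 / 2) * B x x
  have hR : ∀ z ∈ Metric.closedBall (0 : E) ‖x‖, HasFDerivWithinAt R
      (fderiv ℝ f (p + z) - fderiv ℝ f p - B z) (Metric.closedBall 0 ‖x‖) z := by
    intro z hz
    have hz' : z ∈ Metric.ball (0 : E) r := by
      rw [mem_closedBall_zero_iff] at hz
      rw [mem_ball_zero_iff]
      exact hz.trans_lt hx'
    have h3 : HasFDerivAt (fun x => f (p + x)) (fderiv ℝ f (p + z)) z :=
      (hball z hz').2.hasFDerivAt.comp z ((hasFDerivAt_id z).const_add p)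
    have h4 : HasFDerivAt (fun x => B x x) (B z + B.flip z) z := by
      refine (B.hasFDerivAt.clm_apply (hasFDerivAt_id z)).congr_fderiv ?_
      ext w
      simp
    have h5 := ((h3.sub_const (f p)).sub (fderiv ℝ f p).hasFDerivAt).sub (h4.const_mul (1 / 2))
    refine (h5.congr_fderiv ?_).hasFDerivWithinAt
    ext w
    simp [hsymm w z]
    ring
  have hbd : ∀ z ∈ Metric.closedBall (0 : E) ‖x‖,
      ‖fderiv ℝ f (p + z) - fderiv ℝ f p - B z‖ ≤ c * ‖x‖ := by
    intro z hz
    rw [mem_closedBall_zero_iff] at hz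
    exact ((hball z (by simpa using hz.trans_lt hx')).1).trans
      (mul_le_mul_of_nonneg_left hz hc.le)
  have := (convex_closedBall (0 : E) ‖x‖).norm_image_sub_le_of_norm_hasFDerivWithin_le hR hbd
    (Metric.mem_closedBall_self (norm_nonneg _)) (y := x) (by simp)
  have hR0 : R 0 = 0 := by simp [R]
  rw [hR0, sub_zero, sub_zero] at this
  rw [norm_pow, norm_norm, pow_two, ← mul_assoc]
  exact this
end

section
variable {m : ℕ} {S : Set (Euc m)} {p : Euc m} {N : Euc m → Euc m}

/-- Near `p`, a hypersurface with unit normal field `N` is the zero set of a function whose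
differential at `p` is `⟪N p, ·⟫` and whose Hessian, on tangent vectors, is the derivative of
`N`. -/
theorem exists_normalized_defining_function (hS : IsSmoothHypersurface S) (hp : p ∈ S)
    (hN : IsUnitNormalAround S p N) :
    ∃ (U : Set (Euc m)) (f : Euc m → ℝ), IsOpen U ∧ p ∈ U ∧ ContDiffOn ℝ ∞ f U ∧
      S ∩ U = {q ∈ U | f q = 0} ∧ (∀ u, fderiv ℝ f p u = inner ℝ (N p) u) ∧
      ∀ v ∈ tangentSpaceAt S p, ∀ u, inner ℝ (N p) u = 0 →
        fderiv ℝ (fderiv ℝ f) p v u = inner ℝ (fderiv ℝ N p v) u := by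
  obtain ⟨U, f, hU, hpU, hf, hreg, hSU⟩ := hS p hp
  obtain ⟨U', hU', hpU', hNs, hN1⟩ := hN
  have hfat : ∀ q ∈ U, ContDiffAt ℝ ∞ f q := fun q hq => hf.contDiffAt (hU.mem_nhds hq)
  have hfS : ∀ q ∈ U, (q ∈ S ↔ f q = 0) := fun q hq => by
    have : q ∈ S ∩ U ↔ q ∈ {q ∈ U | f q = 0} := by rw [hSU]
    simpa [hq] using this
  have hNp : ContDiffAt ℝ ∞ N p := hNs.contDiffAt (hU'.mem_nhds hpU')
  -- on `S`, the differential of `f` is a multiple of `⟪N q, ·⟫`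
  have hker : ∀ q ∈ S ∩ (U ∩ U'), ∀ v, fderiv ℝ f q v = 0 → inner ℝ (N q) v = 0 := by
    rintro q ⟨hqS, hqU, hqU'⟩ v hv
    refine (hN1 q ⟨hqS, hqU'⟩).2 v (Submodule.subset_span ?_)
    obtain ⟨γ, h0, hs, hz, hd⟩ := exists_curve_of_fderiv_eq_zero (hfat q hqU)
      ((hfS q hqU).1 hqS) (hreg q hqU) hv
    refine ⟨γ, h0, hs, ?_, hd.deriv⟩
    have : ∀ᶠ t in 𝓝 (0 : ℝ), γ t ∈ U :=
      hs.continuousAt.eventually_mem (hU.mem_nhds (by rwa [h0]))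
    filter_upwards [hz, this] with t h1 h2 using (hfS _ h2).2 h1
  have hpar : ∀ q ∈ S ∩ (U ∩ U'), fderiv ℝ f q (N q) ≠ 0 ∧
      ∀ u, fderiv ℝ f q u = fderiv ℝ f q (N q) * inner ℝ (N q) u := by
    intro q hq
    have h1 : inner ℝ (N q) (N q) = (1 : ℝ) := by
      rw [real_inner_self_eq_norm_sq, (hN1 q ⟨hq.1, hq.2.2⟩).1, one_pow]
    have h2 : fderiv ℝ f q (N q) ≠ 0 := fun h0 => by
      have := hker q hq _ h0
      rw [h1] at this
      exact one_ne_zero this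
    refine ⟨h2, fun u => ?_⟩
    have h3 := hker q hq (u - (fderiv ℝ f q u / fderiv ℝ f q (N q)) • N q) (by
      rw [map_sub, map_smul, smul_eq_mul, div_mul_cancel₀ _ h2, sub_self])
    rw [inner_sub_right, real_inner_smul_right, h1] at h3
    field_simp at h3
    linarith
  have hpI : p ∈ S ∩ (U ∩ U') := ⟨hp, hpU, hpU'⟩
  set c := fderiv ℝ f p (N p) with hc
  have hc0 : c ≠ 0 := (hpar p hpI).1
  have hfd : HasFDerivAt (fderiv ℝ f) (fderiv ℝ (fderiv ℝ f) p) p :=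
    (((hfat p hpU).fderiv_right (m := 1) (by norm_cast)).differentiableAt (by simp)).hasFDerivAt
  have hNd : HasFDerivAt N (fderiv ℝ N p) p := (hNp.differentiableAt (by simp)).hasFDerivAt
  -- differentiate the previous relation along curves in `S`
  have hhess : ∀ v ∈ tangentSpaceAt S p, ∀ u, inner ℝ (N p) u = 0 →
      fderiv ℝ (fderiv ℝ f) p v u = c * inner ℝ (fderiv ℝ N p v) u := by
    intro v hv u hu
    induction hv using Submodule.span_induction with
    | mem v hv =>
      obtain ⟨γ, h0, hs, hγS, rfl⟩ := hv
      have hγd : HasDerivAt γ (deriv γ 0) 0 := (hs.differentiableAt (by simp)).hasDerivAt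
      rw [← h0] at hfd hNd
      have hA : HasDerivAt (fun t => fderiv ℝ f (γ t))
        (fderiv ℝ (fderiv ℝ f) (γ 0) (deriv γ 0)) 0 := hfd.comp_hasDerivAt 0 hγd
      have hB : HasDerivAt (fun t => N (γ t)) (fderiv ℝ N (γ 0) (deriv γ 0)) 0 :=
        hNd.comp_hasDerivAt 0 hγd
      have hl := hA.clm_apply (hasDerivAt_const 0 u)
      have hr := (hA.clm_apply hB).mul (hB.inner ℝ (hasDerivAt_const 0 u))
      have heq : (fun t => fderiv ℝ f (γ t) u) =ᶠ[𝓝 0]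
          fun t => fderiv ℝ f (γ t) (N (γ t)) * inner ℝ (N (γ t)) u := by
        have hm : ∀ᶠ t in 𝓝 (0 : ℝ), γ t ∈ U ∩ U' :=
          hs.continuousAt.eventually_mem ((hU.inter hU').mem_nhds (by rw [h0]; exact hpI.2))
        filter_upwards [hγS, hm] with t h1 h2 using (hpar _ ⟨h1, h2⟩).2 u
      have := hl.unique (hr.congr_of_eventuallyEq heq)
      simp only [h0, hu, map_zero, add_zero, mul_zero, zero_add, inner_zero_right] at this
      rw [this]
    | zero => simp
    | add x y _ _ hx hy =>
      rw [map_add, map_add, add_apply, hx, hy, inner_add_left]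
      ring
    | smul a x _ hx =>
      rw [map_smul, map_smul, smul_apply, hx, real_inner_smul_left, smul_eq_mul]
      ring
  refine ⟨U, c⁻¹ • f, hU, hpU, contDiffOn_const.smul hf, ?_, fun u => ?_, fun v hv u hu => ?_⟩
  · rw [hSU]
    simp [hc0]
  · rw [fderiv_const_smul_field, Pi.smul_apply, smul_apply, (hpar p hpI).2 u, smul_eq_mul, ← hc,
      inv_mul_cancel_left₀ hc0]
  · rw [fderiv_const_smul_field, fderiv_const_smul hfd.differentiableAt, smul_apply, smul_apply,
      hhess v hv u hu, smul_eq_mul, inv_mul_cancel_left₀ hc0]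
end

/-! ### The spherical component -/

section
variable {m : ℕ} {S : Set (Euc m)} {p ν : Euc m} {f : Euc m → ℝ} {ε : ℝ}

/-- If `f` is almost linear on a ball, with gradient close to the unit vector `ν`, then the part of
the ball where `f > 0` is star-shaped about the point `p + (ε / 2) ν`. The constant `1 / 8` is small
enough for the two cases, of points below and above the height `ε / 4`. -/
theorem starConvex_superlevel (hε : 0 < ε) (hν : ‖ν‖ = 1) (hp : f p = 0)
    (hlin : ∀ x ∈ Metric.closedBall p ε, ∀ y ∈ Metric.closedBall p ε,
      |f x - f y - inner ℝ ν (x - y)| ≤ 1 / 8 * ‖x - y‖) :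
    StarConvex ℝ (p + (ε / 2) • ν) (Metric.closedBall p ε ∩ {x | 0 < f x}) := by
  have hpB : p ∈ Metric.closedBall p ε := Metric.mem_closedBall_self hε.le
  have hcn : ‖(ε / 2) • ν‖ = ε / 2 := by
    rw [norm_smul, hν, mul_one, Real.norm_eq_abs, abs_of_pos (by positivity)]
  have hνν : inner ℝ ν ν = (1 : ℝ) := by rw [real_inner_self_eq_norm_sq, hν, one_pow]
  have hcB : p + (ε / 2) • ν ∈ Metric.closedBall p ε := by
    rw [mem_closedBall_iff_norm, add_sub_cancel_left, hcn]
    linarith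
  rintro x ⟨hxB, hx⟩ a b ha hb hab
  have hx : 0 < f x := hx
  have hqB := (convex_closedBall p ε) hcB hxB ha hb hab
  refine ⟨hqB, ?_⟩
  set q := a • (p + (ε / 2) • ν) + b • x with hq
  have hxn : ‖x - p‖ ≤ ε := mem_closedBall_iff_norm.1 hxB
  obtain rfl : b = 1 - a := by linarith
  rw [Set.mem_ofPred_eq]
  rcases le_or_gt (inner ℝ ν (x - p)) (ε / 4) with hz | hz
  · -- `f` increases along the segment from `x` to the centre
    have h1 : q - x = a • ((ε / 2) • ν - (x - p)) := by
      rw [hq]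
      module
    have h2 : ‖q - x‖ ≤ a * (3 / 2 * ε) := by
      rw [h1, norm_smul, Real.norm_eq_abs, abs_of_nonneg ha]
      refine mul_le_mul_of_nonneg_left ((norm_sub_le _ _).trans ?_) ha
      rw [hcn]
      linarith
    have h3 : inner ℝ ν (q - x) = a * (ε / 2 - inner ℝ ν (x - p)) := by
      rw [h1, real_inner_smul_right, inner_sub_right, real_inner_smul_right, hνν, mul_one]
    have h4 := (abs_le.1 (hlin q hqB x hxB)).1
    nlinarith
  · -- the whole segment stays at height at least `ε / 4`
    have h1 : q - p = a • ((ε / 2) • ν) + (1 - a) • (x - p) := by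
      rw [hq]
      module
    have h2 : ‖q - p‖ ≤ ε := mem_closedBall_iff_norm.1 hqB
    have h3 : inner ℝ ν (q - p) = a * (ε / 2) + (1 - a) * inner ℝ ν (x - p) := by
      rw [h1, inner_add_right, real_inner_smul_right, real_inner_smul_right, real_inner_smul_right,
        hνν, mul_one]
    have h4 := (abs_le.1 (hlin q hqB p hpB)).1
    rw [hp] at h4
    nlinarith

/-- In a small ball, the spherical component is where the defining function is positive. -/
theorem sphericalComponent_eq (hε : 0 < ε) (hν : ‖ν‖ = 1) (hp : f p = 0)
    (hlin : ∀ x ∈ Metric.closedBall p ε, ∀ y ∈ Metric.closedBall p ε,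
      |f x - f y - inner ℝ ν (x - y)| ≤ 1 / 8 * ‖x - y‖)
    (hf : ContinuousOn f (Metric.closedBall p ε))
    (hS : ∀ x ∈ Metric.closedBall p ε, (x ∈ S ↔ f x = 0)) :
    sphericalComponent S p ν ε = Metric.closedBall p ε ∩ {x | 0 < f x} := by
  have hpB : p ∈ Metric.closedBall p ε := Metric.mem_closedBall_self hε.le
  have hray : ∀ t, 0 < t → t ≤ ε → p + t • ν ∈ Metric.closedBall p ε ∩ {x | 0 < f x} := by
    intro t ht0 htε
    have h1 : ‖t • ν‖ = t := by rw [norm_smul, hν, mul_one, Real.norm_eq_abs, abs_of_pos ht0]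
    have h2 : p + t • ν ∈ Metric.closedBall p ε := by
      rwa [mem_closedBall_iff_norm, add_sub_cancel_left, h1]
    refine ⟨h2, ?_⟩
    have h3 := (abs_le.1 (hlin _ h2 p hpB)).1
    rw [hp, add_sub_cancel_left, h1, real_inner_smul_right, real_inner_self_eq_norm_sq, hν] at h3
    rw [Set.mem_ofPred_eq]
    linarith
  have hsub : Metric.closedBall p ε ∩ {x | 0 < f x} ⊆ Metric.closedBall p ε \ S :=
    fun x hx => ⟨hx.1, fun h => (show 0 < f x from hx.2).ne' ((hS x hx.1).1 h)⟩
  refine Set.Subset.antisymm (fun x hx => ?_) (fun x hx => ?_)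
  · have hx : ∀ᶠ t in 𝓝[>] (0 : ℝ),
        x ∈ connectedComponentIn (Metric.closedBall p ε \ S) (p + t • ν) := hx
    obtain ⟨t, ht, ht0, htε⟩ := (hx.and (Ioc_mem_nhdsGT hε)).exists
    have hr := hray t ht0 htε
    have hC := connectedComponentIn_subset (Metric.closedBall p ε \ S) (p + t • ν)
    refine ⟨(hC ht).1, ?_⟩
    by_contra hneg
    obtain ⟨z, hz, hz0⟩ := isPreconnected_connectedComponentIn.intermediate_value ht
      (mem_connectedComponentIn (hsub hr)) (hf.mono fun y hy => (hC hy).1)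
      (show (0 : ℝ) ∈ Set.Icc _ _ from ⟨not_lt.1 hneg, (show 0 < f _ from hr.2).le⟩)
    exact (hC hz).2 ((hS z (hC hz).1).2 hz0)
  · filter_upwards [Ioc_mem_nhdsGT hε] with t ht
    exact (StarConvex.isPathConnected (starConvex_superlevel hε hν hp hlin)
      (hray _ (half_pos hε) (half_le_self hε.le))).isConnected.isPreconnected
        |>.subset_connectedComponentIn (hray t ht.1 ht.2) hsub hx
end

/-! ### The spherical component as a graph region -/

section
variable {n : ℕ} {b : OrthonormalBasis (Fin (n + 1)) ℝ (Euc (n + 1))} {κ : Fin n → ℝ}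
  {p : Euc (n + 1)} {f : Euc (n + 1) → ℝ}

/-- The blow-up of `f` in the parabolic scaling (`ε` in tangent, `ε²` in normal directions). -/
theorem tendsto_div_sq_of_taylor (hf : ContDiffAt ℝ 2 f p) (hp : f p = 0)
    (hgrad : ∀ u, fderiv ℝ f p u = inner ℝ (b (Fin.last n)) u)
    (hhess : ∀ y, fderiv ℝ (fderiv ℝ f) p (graphCoord b (y, 0)) (graphCoord b (y, 0)) =
      -2 * curvatureForm κ y) (y : Euc n) (t : ℝ) :
    Tendsto (fun ε : ℝ => f (p + ε • graphCoord b (y, ε * t)) / ε ^ 2) (𝓝[>] 0)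
      (𝓝 (t - curvatureForm κ y)) := by
  have hR := taylor_two_isLittleO hf
  set B := fderiv ℝ (fderiv ℝ f) p
  have hW : Tendsto (fun ε : ℝ => graphCoord b (y, ε * t)) (𝓝[>] 0) (𝓝 (graphCoord b (y, 0))) := by
    have : Tendsto (fun ε : ℝ => graphCoord b (y, ε * t)) (𝓝 0) (𝓝 (graphCoord b (y, 0 * t))) :=
      Continuous.tendsto ((continuous_graphCoord b).comp (by fun_prop)) 0
    rw [zero_mul] at this
    exact this.mono_left nhdsWithin_le_nhds
  have hε0 : Tendsto (fun ε : ℝ => ε) (𝓝[>] 0) (𝓝 0) := nhdsWithin_le_nhds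
  have hX : Tendsto (fun ε : ℝ => ε • graphCoord b (y, ε * t)) (𝓝[>] 0) (𝓝 0) := by
    simpa using hε0.smul hW
  have hO : (fun ε : ℝ => ‖ε • graphCoord b (y, ε * t)‖ ^ 2) =O[𝓝[>] 0] fun ε : ℝ => ε ^ 2 := by
    have h1 := (Asymptotics.isBigO_refl (fun ε : ℝ => ε ^ 2) (𝓝[>] (0 : ℝ))).mul
      ((hW.norm.pow 2).isBigO_one ℝ)
    simpa [norm_smul, mul_pow] using h1
  have h1 := ((hR.comp_tendsto hX).trans_isBigO hO).tendsto_div_nhds_zero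
  have h2 : Tendsto (fun ε : ℝ => B (graphCoord b (y, ε * t)) (graphCoord b (y, ε * t))) (𝓝[>] 0)
      (𝓝 (-2 * curvatureForm κ y)) := by
    rw [← hhess]
    have hc : Continuous fun w => B w w := by fun_prop
    exact (hc.tendsto _).comp hW
  have h3 := (h1.add (h2.const_mul (1 / 2))).const_add t
  rw [show t + (0 + 1 / 2 * (-2 * curvatureForm κ y)) = t - curvatureForm κ y by ring] at h3
  refine h3.congr' ?_
  filter_upwards [self_mem_nhdsWithin] with ε (hε : 0 < ε)
  simp only [Function.comp_apply, hp, hgrad, map_smul, smul_apply, real_inner_smul_right,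
    inner_last_graphCoord, smul_eq_mul]
  field_simp
  ring

/-- The linear part of `f` determines its sign outside a layer of thickness `O(ε)` in the rescaled
ball. -/
theorem exists_layer_bound (hf : ContDiffAt ℝ 2 f p) (hp : f p = 0) {ν : Euc (n + 1)}
    (hgrad : ∀ u, fderiv ℝ f p u = inner ℝ ν u) :
    ∃ K : ℝ, 0 ≤ K ∧ ∀ᶠ ε in 𝓝[>] (0 : ℝ), ∀ w ∈ Metric.closedBall (0 : Euc (n + 1)) 1,
      |f (p + ε • w) - ε * inner ℝ ν w| ≤ K * ε ^ 2 := by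
  have hR := (taylor_two_isLittleO hf).def one_pos
  set B := fderiv ℝ (fderiv ℝ f) p
  obtain ⟨r, hr, hball⟩ := Metric.eventually_nhds_iff_ball.1 hR
  refine ⟨1 + 1 / 2 * ‖B‖, by positivity, ?_⟩
  filter_upwards [Ioo_mem_nhdsGT hr] with ε ⟨hε, hεr⟩ w hw
  rw [mem_closedBall_zero_iff] at hw
  have h1 : ‖ε • w‖ ≤ ε := by
    rw [norm_smul, Real.norm_eq_abs, abs_of_pos hε]
    nlinarith
  have h2 := hball (ε • w) (by rw [mem_ball_zero_iff]; exact h1.trans_lt hεr)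
  have h3 : |B (ε • w) (ε • w)| ≤ ‖B‖ * ε ^ 2 := by
    refine (B.le_opNorm₂ _ _).trans ?_
    rw [mul_assoc, ← pow_two]
    gcongr
  rw [hp, hgrad, real_inner_smul_right, norm_pow, norm_norm, one_mul, Real.norm_eq_abs] at h2
  have h4 : ‖ε • w‖ ^ 2 ≤ ε ^ 2 := by gcongr
  have h5 := abs_le.1 h2
  have h6 := abs_le.1 h3
  rw [abs_le]
  constructor <;> linarith [h5.1, h5.2, h6.1, h6.2]

theorem isGraphRegion_superlevel {U : Set (Euc (n + 1))} (hU : IsOpen U) (hpU : p ∈ U)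
    (hfU : ContinuousOn f U) (hf : ContDiffAt ℝ 2 f p) (hp : f p = 0)
    (hgrad : ∀ u, fderiv ℝ f p u = inner ℝ (b (Fin.last n)) u)
    (hhess : ∀ y, fderiv ℝ (fderiv ℝ f) p (graphCoord b (y, 0)) (graphCoord b (y, 0)) =
      -2 * curvatureForm κ y) {D : ℝ → Set (Euc (n + 1))}
    (hD : ∀ᶠ ε in 𝓝[>] (0 : ℝ), D ε = Metric.closedBall p ε ∩ {x | 0 < f x}) :
    IsGraphRegion b (curvatureForm κ) (fun ε => {w | p + ε • w ∈ D ε}) := by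
  have hmem : ∀ᶠ ε in 𝓝[>] (0 : ℝ), ∀ w, p + ε • w ∈ D ε ↔
      w ∈ Metric.closedBall 0 1 ∧ 0 < f (p + ε • w) := by
    filter_upwards [hD, self_mem_nhdsWithin] with ε hDε (hε : 0 < ε) w
    rw [hDε, Set.mem_inter_iff, mem_closedBall_iff_norm, add_sub_cancel_left, norm_smul,
      Real.norm_eq_abs, abs_of_pos hε, mul_le_iff_le_one_right hε, mem_closedBall_zero_iff]
    rfl
  have hunit : ∀ (y : Euc n) (t : ℝ), ‖y‖ < 1 →
      ∀ᶠ ε in 𝓝[>] (0 : ℝ), graphCoord b (y, ε * t) ∈ Metric.closedBall 0 1 := by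
    intro y t hy
    have h1 : Tendsto (fun ε : ℝ => ‖y‖ ^ 2 + (ε * t) ^ 2) (𝓝[>] 0)
        (𝓝 (‖y‖ ^ 2 + (0 * t) ^ 2)) :=
      (Continuous.tendsto (by fun_prop) 0).mono_left nhdsWithin_le_nhds
    have hy' : ‖y‖ ^ 2 + (0 * t) ^ 2 < 1 := by nlinarith [norm_nonneg y]
    filter_upwards [h1.eventually_lt_const hy'] with ε h2
    rw [mem_closedBall_zero_iff, ← sq_le_one_iff₀ (norm_nonneg _), norm_sq_graphCoord]
    exact h2.le
  refine ⟨?_, ?_, fun y t hy ht => ?_, fun y t hy ht => ?_, ?_⟩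
  · obtain ⟨r, hr, hrU⟩ := Metric.isOpen_iff.1 hU p hpU
    filter_upwards [hD, Ioo_mem_nhdsGT hr] with ε hDε ⟨hε, hεr⟩
    have h1 : Metric.closedBall p ε ∩ {x | 0 < f x} =
        Metric.closedBall p ε ∩ (U ∩ f ⁻¹' Set.Ioi 0) := by
      ext x
      have : x ∈ Metric.closedBall p ε → x ∈ U := fun hx =>
        hrU (Metric.closedBall_subset_ball hεr hx)
      simp only [Set.mem_inter_iff, Set.mem_ofPred_eq, Set.mem_preimage, Set.mem_Ioi]
      tauto
    have hm : Measurable fun w : Euc (n + 1) => p + ε • w := by fun_prop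
    refine hm (t := D ε) ?_
    rw [hDε, h1]
    exact measurableSet_closedBall.inter (hfU.isOpen_inter_preimage hU isOpen_Ioi).measurableSet
  · filter_upwards [hmem] with ε h w hw using ((h w).1 hw).1
  · filter_upwards [hmem, hunit y t hy, self_mem_nhdsWithin,
      (tendsto_div_sq_of_taylor hf hp hgrad hhess y t).eventually_const_lt (sub_pos.2 ht)]
      with ε h1 h2 (h3 : 0 < ε) h4
    exact (h1 _).2 ⟨h2, (div_pos_iff_of_pos_right (by positivity)).1 h4⟩
  · filter_upwards [hmem, self_mem_nhdsWithin,
      (tendsto_div_sq_of_taylor hf hp hgrad hhess y t).eventually_lt_const (sub_neg.2 ht)]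
      with ε h1 (h3 : 0 < ε) h4 h5
    exact h4.not_gt (div_pos ((h1 _).1 h5).2 (by positivity))
  · obtain ⟨K, hK0, hK⟩ := exists_layer_bound hf hp hgrad
    refine ⟨K, hK0, ?_⟩
    filter_upwards [hmem, hK, self_mem_nhdsWithin] with ε h1 h2 (h3 : 0 < ε) w hw
    have h4 := abs_le.1 (h2 w hw)
    refine ⟨fun h => (h1 w).2 ⟨hw, ?_⟩, fun h h5 => ?_⟩
    · nlinarith
    · nlinarith [((h1 w).1 h5).2]

theorem eventually_sphericalComponent_eq {m : ℕ} {S U : Set (Euc m)} {p ν : Euc m} {f : Euc m → ℝ}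
    (hU : IsOpen U) (hpU : p ∈ U) (hfU : ContDiffOn ℝ ∞ f U) (hSU : S ∩ U = {q ∈ U | f q = 0})
    (hp : f p = 0) (hν : ‖ν‖ = 1) (hgrad : ∀ u, fderiv ℝ f p u = inner ℝ ν u) :
    ∀ᶠ ε in 𝓝[>] (0 : ℝ), sphericalComponent S p ν ε = Metric.closedBall p ε ∩ {x | 0 < f x} := by
  have hs : HasStrictFDerivAt f (fderiv ℝ f p) p :=
    (hfU.contDiffAt (hU.mem_nhds hpU)).hasStrictFDerivAt (by simp)
  obtain ⟨s, hs, happ⟩ := hs.approximates_deriv_on_nhds (c := 1 / 8) (Or.inr (by norm_num))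
  obtain ⟨r, hr, hball⟩ := Metric.mem_nhds_iff.1 (inter_mem hs (hU.mem_nhds hpU))
  filter_upwards [Ioo_mem_nhdsGT hr] with ε ⟨hε, hεr⟩
  have hsub : ∀ x ∈ Metric.closedBall p ε, x ∈ s ∩ U := fun x hx =>
    hball (Metric.closedBall_subset_ball hεr hx)
  refine sphericalComponent_eq hε hν hp (fun x hx y hy => ?_)
    (hfU.continuousOn.mono fun x hx => (hsub x hx).2) (fun x hx => ?_)
  · have := happ x (hsub x hx).1 y (hsub y hy).1
    rw [hgrad] at this
    simpa using this
  · have : x ∈ S ∩ U ↔ x ∈ {q ∈ U | f q = 0} := by rw [hSU]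
    simpa [(hsub x hx).2] using this

/-- Completes an orthonormal basis of a hyperplane by a unit normal. -/
theorem exists_orthonormalBasis_extending {E : Type*} [NormedAddCommGroup E]
    [InnerProductSpace ℝ E] [FiniteDimensional ℝ E] (hE : Module.finrank ℝ E = n + 1)
    {T : Submodule ℝ E} (e : OrthonormalBasis (Fin n) ℝ T) {ν : E} (hν : ‖ν‖ = 1)
    (hT : ∀ v ∈ T, inner ℝ ν v = 0) :
    ∃ b : OrthonormalBasis (Fin (n + 1)) ℝ E,
      (∀ i, b (Fin.castSucc i) = e i) ∧ b (Fin.last n) = ν := by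
  let v : Fin (n + 1) → E := Fin.lastCases ν fun i => (e i : E)
  have hv : Orthonormal ℝ v := by
    rw [orthonormal_iff_ite]
    intro i j
    induction i using Fin.lastCases with
    | last =>
      induction j using Fin.lastCases with
      | last => simp [v, hν]
      | cast j => simp [v, hT _ (e j).2, (Fin.castSucc_lt_last j).ne']
    | cast i =>
      induction j using Fin.lastCases with
      | last => simp [v, real_inner_comm, hT _ (e i).2, (Fin.castSucc_lt_last i).ne]
      | cast j =>
        have := orthonormal_iff_ite.1 e.orthonormal i j
        simpa [v] using this
  have hcard : Fintype.card (Fin (n + 1)) = Module.finrank ℝ E := by simp [hE]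
  refine ⟨(basisOfOrthonormalOfCardEqFinrank hv hcard).toOrthonormalBasis (by simpa using hv),
    fun i => by simp [v], by simp [v]⟩

theorem isGraphRegion_sphericalComponent {S : Set (Euc (n + 1))} (hS : IsSmoothHypersurface S)
    (hpS : p ∈ S) {N : Euc (n + 1) → Euc (n + 1)} (hN : IsUnitNormalAround S p N)
    (hκ : IsPrincipalCurvatures S p N κ) :
    ∃ b : OrthonormalBasis (Fin (n + 1)) ℝ (Euc (n + 1)), IsGraphRegion b (curvatureForm κ)
      (fun ε => {w | p + ε • w ∈ sphericalComponent S p (N p) ε}) := by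
  obtain ⟨U', -, hpU', -, hN1⟩ := id hN
  obtain ⟨hNp, hNT⟩ := hN1 p ⟨hpS, hpU'⟩
  obtain ⟨e, he⟩ := hκ
  obtain ⟨b, hbe, hbν⟩ := exists_orthonormalBasis_extending (by simp) e hNp hNT
  obtain ⟨U, f, hU, hpU, hfU, hSU, hgrad, hhess⟩ := exists_normalized_defining_function hS hpS hN
  have hp0 : f p = 0 := by
    have : p ∈ S ∩ U := ⟨hpS, hpU⟩
    rw [hSU] at this
    exact this.2
  have hshape : ∀ i, fderiv ℝ N p (b i.castSucc) = -(κ i • b i.castSucc) := fun i => by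
    have := he i
    rw [weingartenMap] at this
    simp only [neg_apply, ContinuousLinearMap.comp_apply, Submodule.subtypeL_apply] at this
    rw [hbe, ← this, neg_neg]
  refine ⟨b, isGraphRegion_superlevel hU hpU hfU.continuousOn
    ((hfU.contDiffAt (hU.mem_nhds hpU)).of_le (by norm_cast)) hp0 (by rwa [hbν]) (fun y => ?_)
    (eventually_sphericalComponent_eq hU hpU hfU hSU hp0 hNp hgrad)⟩
  have hy : graphCoord b (y, 0) = ∑ i, y i • b i.castSucc := by simp [graphCoord_eq]
  have hyT : graphCoord b (y, 0) ∈ tangentSpaceAt S p := by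
    rw [hy]
    refine Submodule.sum_mem _ fun i _ => Submodule.smul_mem _ _ ?_
    rw [hbe]
    exact (e i).2
  rw [hhess _ hyT _ (hNT _ hyT)]
  conv_lhs => enter [2]; rw [hy, map_sum]
  rw [sum_inner, curvatureForm, mul_div_assoc', mul_comm (-2), ← mul_div_assoc', Finset.sum_mul]
  refine Finset.sum_congr rfl fun i _ => ?_
  rw [map_smul, hshape, real_inner_smul_left, inner_neg_left, real_inner_smul_left,
    inner_castSucc_graphCoord]
  ring
end

theorem mainTheorem8 (n : ℕ) (S : Set (Euc (n + 1))) (hS : IsSmoothHypersurface S)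
    (p : Euc (n + 1)) (hp : p ∈ S)
    (N : Euc (n + 1) → Euc (n + 1)) (hN : IsUnitNormalAround S p N)
    (κ : Fin n → ℝ) (hκ : IsPrincipalCurvatures S p N κ)
    (lam : ℝ → Fin (n + 1) → ℝ)
    (hlam : ∀ᶠ ε in 𝓝[>] (0 : ℝ),
      IsEigenvalueList (covarianceMatrix (sphericalComponent S p (N p) ε)) (lam ε) ∧
        IsCurvatureLabelling κ (lam ε))
    (μ ν : Fin n) :
    Tendsto
      (fun ε : ℝ => ballVolume (n + 1) ε ^ 2 / ballVolume n ε *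
        ((lam ε μ.castSucc - lam ε ν.castSucc) / (lam ε μ.castSucc * lam ε ν.castSucc)))
      (𝓝[>] (0 : ℝ))
      (𝓝 (4 * ((n : ℝ) + 3) ^ 2 / (((n : ℝ) + 2) * ((n : ℝ) + 4)) * (κ ν - κ μ))) := by
  obtain ⟨b, hb⟩ := isGraphRegion_sphericalComponent hS hp hN hκ
  exact tendsto_eigenvalue_ratio hb hlam μ ν
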